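/- Let $\alpha,\beta,\gamma$ be positive integers. **Notation.** For an index $\boldsymbol k=(k_1,\dots,k_d)$ of positive integers, $\zeta^{\ast}(\boldsymbol k)=Z^{\ast}(\boldsymbol k;0)$ is the stuffle regularized multiple zeta value: $Z^{\ast}$ is the unique $\mathbb{Q}$-algebra homomorphism from the stuffle algebra $\mathbb{Q}\langle z_1,z_2,\dots\rangle$ to $\mathbb{R}[T]$ with $Z^{\ast}(z_1)=T$ and $Z^{\ast}(z_{k_1}\cdots z_{k_d})=\zeta(k_1,\dots,k_d)=\sum_{1\le m_1<\cdots<m_d}m_1^{-k_1}\cdots m_d^{-k_d}$ when $k_d\ge 2$. For a Young diagram $\lambda$ filled with positive integers $s_{ij}$, $\zeta^{\ast}_\lambda(\boldsymbol s)=Z^{\ast}_\lambda(\boldsymbol s;0)$ is the regularized Schur multiple zeta value, where $Z^{\ast}_\lambda(\boldsymbol s;T)\in\mathbb{R}[T]$ is the unique polynomial such that $$\sum_{t}\prod_{(i,j)\in\lambda}t_{ij}^{-s_{ij}}=Z^{\ast}_\lambda(\boldsymbol s;\log M+\gamma_E)+O\!\left(\frac{\log^J M}{M}\right)\quad(M\to\infty)$$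 for some $J>0$; the sum is over the semistandard Young tableaux $t$ of shape $\lambda$ with entries in $\{1,\dots,M\}$, and $\gamma_E$ is the Euler constant. For $m\in\mathbb{Z}$ and $p,q\ge1$, $R^{(m)}_{p,q}$ is the regularized Schur multiple zeta value of the rectangle with $p$ rows and $q$ columns whose entry in row $i$ and column $j$ is $\gamma$, $\beta$ or $\alpha$ according to whether $j-i+m$ is negative, zero or positive. With $\{\alpha\}^a$ denoting $\alpha$ repeated $a$ times, put $$F(x,z)=\sum_{a,c\ge 0}\zeta^{\ast}(\{\alpha\}^a,\beta,\{\gamma\}^c)\,x^az^c,$$ $$\Phi_b(x,z)=x^{\frac12 b(b-1)}z^{\frac12(b-1)(b-2)}\sum_{a,c\ge0}R^{(a)}_{a+b+c,b}\,x^{(b-1)a}z^{(b-1)c}\qquad(b\ge 2).$$ Say that $F$ converges at $(A,B)$, for reals $A,B\ge0$, if $\sum_{a,c\ge0}|\zeta^{\ast}(\{\alpha\}^a,\beta,\{\gamma\}^c)|A^aB^c<\infty$. **Theorem.** Let $b\ge2$ and write $X=x_2\cdots x_b$, $Z=z_2\cdots z_b$. (1) Let $x,z\in\mathbb{C}$ be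 such that $F$ converges at $(1,1)$ and at $(|x|,|z|)$. Then $$\Phi_b(x,z)=\frac{1}{(2\pi i)^{2(b-1)}}\int_{\mathcal C}\ \prod_{2\le i<j\le b}(x_j-x_i)\cdot\frac{F(X,Z)}{X^b}\prod_{i=2}^b\frac{Xx_i-x}{z_i^{\,i}}\,F\!\left(\frac{x}{x_i},\frac{z}{z_i}\right)dx_i\,dz_i,$$ where $\mathcal C$ is the positively oriented product of the unit circles $|x_i|=1$, $|z_i|=1$ $(2\le i\le b)$; the integrand is integrable over $\mathcal C$, and the series of the terms $x^{\frac12 b(b-1)}z^{\frac12(b-1)(b-2)}R^{(a)}_{a+b+c,b}x^{(b-1)a}z^{(b-1)c}$ converges absolutely. (2) More generally, the same holds over the product of the circles $|x_i|=\rho_i$, $|z_i|=\sigma_i$ for any radii $\rho_i,\sigma_i>0$ such that $F$ converges at $(\rho_2\cdots\rho_b,\ \sigma_2\cdots\sigma_b)$ and at $(|x|/\rho_i,\ |z|/\sigma_i)$ for $2\le i\le b$. (3) For all positive integers $\alpha,\beta,\gamma$ there is $r>0$ such that $F$ converges at $(r,r)$; hence the formula in (2) always holds for suitable small radii and all $(x,z)$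 near $(0,0)$. -/

import Mathlib

namespace SchurMZV

noncomputable section

/-! ### Multiple zeta values and their stuffle regularization -/

/-- The truncated multiple zeta value
`ζ^M(k₁, …, k_d) = ∑_{1 ≤ m₁ < ⋯ < m_d ≤ M} m₁^{-k₁} ⋯ m_d^{-k_d}`
(`m i : Fin M` stands for the integer `m i + 1` in `{1, …, M}`). -/
def truncMZV (k : List ℕ+) (M : ℕ) : ℝ :=
  open scoped Classical in
  ∑ m : Fin k.length → Fin M with StrictMono m,
    ∏ i, (((m i : ℕ) + 1 : ℝ) ^ (k.get i : ℕ))⁻¹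

/-- An index is admissible if it is empty or its last entry is at least `2`. -/
def Admissible (k : List ℕ+) : Prop := ∀ a ∈ k.getLast?, 2 ≤ a

/-- The multiple zeta value `ζ(k) = lim_{M → ∞} ζ^M(k)`; it is used for admissible `k`. -/
def mzv (k : List ℕ+) : ℝ := Filter.limUnder Filter.atTop (truncMZV k)

/-- The stuffle (harmonic) product of the words `z_{k₁} ⋯ z_{k_d}` and `z_{l₁} ⋯ z_{l_e}`, as the
list (with multiplicities) of the words that occur in it:
`z_a u ∗ z_b v = z_a (u ∗ z_b v) + z_b (z_a u ∗ v) + z_{a+b} (u ∗ v)`. -/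
def stuffle : List ℕ+ → List ℕ+ → List (List ℕ+)
  | [], v => [v]
  | a :: u, [] => [a :: u]
  | a :: u, b :: v =>
      (stuffle u (b :: v)).map (List.cons a) ++ (stuffle (a :: u) v).map (List.cons b) ++
        (stuffle u v).map (List.cons (a + b))
termination_by u v => u.length + v.length

/-- `Z`, extended linearly from words to the Hoffman algebra `ℌ¹ = ℚ⟨z₁, z₂, …⟩`, is a homomorphism
from `(ℌ¹, ∗)` to `ℝ[T]` that extends `k ↦ ζ(k)` on admissible words and sends `z₁` to `T`. There
is exactly one such `Z`. -/
structure IsStuffleRegularization (Z : List ℕ+ → Polynomial ℝ) : Prop where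
  admissible : ∀ k, Admissible k → Z k = Polynomial.C (mzv k)
  one : Z [1] = Polynomial.X
  mul : ∀ u v, Z u * Z v = ((stuffle u v).map Z).sum

open scoped Classical in
/-- The stuffle regularization `Z^∗(k; T) ∈ ℝ[T]`. -/
def stuffleReg : List ℕ+ → Polynomial ℝ :=
  if h : ∃ Z, IsStuffleRegularization Z then h.choose else 0

/-- The stuffle regularized multiple zeta value `ζ^∗(k) = Z^∗(k; 0)`. -/
def regMZV (k : List ℕ+) : ℝ := (stuffleReg k).eval 0

/-! ### Regularized Schur multiple zeta values -/

/-- The semistandard tableaux of shape `μ` with entries in `{1, …, M}`. -/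
def ssyt (μ : YoungDiagram) (M : ℕ) : Set (SemistandardYoungTableau μ) :=
  {t | ∀ c ∈ μ.cells, 1 ≤ t c.1 c.2 ∧ t c.1 c.2 ≤ M}

theorem ssyt_finite (μ : YoungDiagram) (M : ℕ) : (ssyt μ M).Finite := by
  classical
  let f : SemistandardYoungTableau μ → (μ.cells → ℕ) := fun t c => t c.1.1 c.1.2
  refine Set.Finite.of_finite_image (f := f) ?_ ?_
  · refine (Set.finite_Icc (fun _ => 0 : μ.cells → ℕ) (fun _ => M)).subset ?_
    rintro _ ⟨t, ht, rfl⟩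
    exact ⟨fun c => Nat.zero_le _, fun c => (ht c.1 c.2).2⟩
  · intro t _ t' _ h
    ext i j
    by_cases hc : (i, j) ∈ μ
    · exact congrFun h ⟨(i, j), (YoungDiagram.mem_cells _).2 hc⟩
    · rw [t.zeros hc, t'.zeros hc]

/-- The truncated Schur multiple zeta value `ζ^M_μ(s)`, the (finite) sum over the semistandard
tableaux `t` of shape `μ` with entries in `{1, …, M}` of `∏ t_{ij}^{-s_{ij}}`. -/
def truncSchurMZV (μ : YoungDiagram) (s : ℕ × ℕ → ℕ+) (M : ℕ) : ℝ :=
  ∑ᶠ t ∈ ssyt μ M, ∏ c ∈ μ.cells, ((t c.1 c.2 : ℝ) ^ (s c : ℕ))⁻¹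

/-- `P` satisfies `ζ^M_μ(s) = P(log M + γ) + O(log^J M / M)` as `M → ∞` for some `J > 0`, where `γ`
is the Euler constant. There is exactly one such polynomial. -/
def IsSchurRegularization (μ : YoungDiagram) (s : ℕ × ℕ → ℕ+) (P : Polynomial ℝ) : Prop :=
  ∃ J : ℕ, 0 < J ∧
    (fun M : ℕ => truncSchurMZV μ s M - P.eval (Real.log M + Real.eulerMascheroniConstant))
      =O[Filter.atTop] (fun M : ℕ => Real.log M ^ J / M)

open scoped Classical in
/-- The regularized Schur multiple zeta polynomial `Z^∗_μ(s; T)`. -/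
def schurReg (μ : YoungDiagram) (s : ℕ × ℕ → ℕ+) : Polynomial ℝ :=
  if h : ∃ P, IsSchurRegularization μ s P then h.choose else 0

/-- The regularized Schur multiple zeta value `ζ^∗_μ(s) = Z^∗_μ(s; 0)`. -/
def regSchurMZV (μ : YoungDiagram) (s : ℕ × ℕ → ℕ+) : ℝ := (schurReg μ s).eval 0

/-- The rectangle `[p | q]` with `p` rows and `q` columns. -/
def rect (p q : ℕ) : YoungDiagram where
  cells := Finset.range p ×ˢ Finset.range q
  isLowerSet := by
    rintro ⟨i, j⟩ ⟨i', j'⟩ h h'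
    simp only [Prod.mk_le_mk] at h
    simp only [Finset.coe_product, Finset.coe_range, Set.mem_prod, Set.mem_Iio] at h' ⊢
    omega

/-- The sequence `(a_c)_{c ∈ ℤ}` with `a_c = γ` for `c < 0`, `a_0 = β`, `a_c = α` for `c > 0`. -/
def diagSeq (α β γ : ℕ+) (c : ℤ) : ℕ+ := if c < 0 then γ else if c = 0 then β else α

/-- `R^{(m)}_{p,q}(α, β, γ)`: the regularized Schur multiple zeta value of shape `[p | q]` whose
entry in the cell `(i, j)` is `a_{j - i + m}`. -/
def R (α β γ : ℕ+) (m : ℤ) (p q : ℕ) : ℝ :=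
  if p = 0 ∨ q = 0 then 1
  else regSchurMZV (rect p q) (fun ij => diagSeq α β γ ((ij.2 : ℤ) - (ij.1 : ℤ) + m))

/-! ### Generating functions -/

/-- `ζ^∗({α}^a, β, {γ}^c)`. -/
def zetaStar (α β γ : ℕ+) (a c : ℕ) : ℝ :=
  regMZV (List.replicate a α ++ β :: List.replicate c γ)

/-- The power series `∑_{a,c ≥ 0} ζ^∗({α}^a, β, {γ}^c) x^a z^c` converges absolutely for `|x| = A`
and `|z| = B`. -/
def FConvergesAt (α β γ : ℕ+) (A B : ℝ) : Prop :=
  Summable fun p : ℕ × ℕ => |zetaStar α β γ p.1 p.2| * A ^ p.1 * B ^ p.2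

/-- `F(x, z) = ∑_{a,c ≥ 0} ζ^∗({α}^a, β, {γ}^c) x^a z^c`. -/
def F (α β γ : ℕ+) (x z : ℂ) : ℂ :=
  ∑' p : ℕ × ℕ, (zetaStar α β γ p.1 p.2 : ℂ) * x ^ p.1 * z ^ p.2

/-- The factor `x^{b(b-1)/2} z^{(b-1)(b-2)/2}`. -/
def PhiFactor (b : ℕ) (x z : ℂ) : ℂ :=
  x ^ (b * (b - 1) / 2) * z ^ ((b - 1) * (b - 2) / 2)

/-- The term `R^{(a)}_{a+b+c,b} x^{(b-1)a} z^{(b-1)c}`, where `p = (a, c)`. -/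
def PhiTerm (α β γ : ℕ+) (b : ℕ) (x z : ℂ) (p : ℕ × ℕ) : ℂ :=
  (R α β γ (p.1 : ℤ) (p.1 + b + p.2) b : ℂ) * x ^ ((b - 1) * p.1) * z ^ ((b - 1) * p.2)

/-- `Φ_b(x, z) = x^{b(b-1)/2} z^{(b-1)(b-2)/2} ∑_{a,c ≥ 0} R^{(a)}_{a+b+c,b} x^{(b-1)a} z^{(b-1)c}`. -/
def Phi (α β γ : ℕ+) (b : ℕ) (x z : ℂ) : ℂ :=
  PhiFactor b x z * ∑' p : ℕ × ℕ, PhiTerm α β γ b x z p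

/-- The integrand
`∏_{2 ≤ i < j ≤ b} (x_j - x_i) · F(X, Z) / X^b · ∏_{i=2}^b (X x_i - x) / z_i^i · F(x/x_i, z/z_i)`
with `X = x_2 ⋯ x_b` and `Z = z_2 ⋯ z_b`. The variables `x_2, …, x_b, z_2, …, z_b` are listed in
this order in `w`, and `i : Fin (b - 1)` stands for the index `i + 2` in `{2, …, b}`. -/
def integrand (α β γ : ℕ+) (b : ℕ) (x z : ℂ) (w : Fin ((b - 1) + (b - 1)) → ℂ) : ℂ :=
  let xs : Fin (b - 1) → ℂ := fun i => w (Fin.castAdd (b - 1) i)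
  let zs : Fin (b - 1) → ℂ := fun i => w (Fin.natAdd (b - 1) i)
  let X : ℂ := ∏ i, xs i
  let Z : ℂ := ∏ i, zs i
  (∏ i, ∏ j ∈ Finset.Ioi i, (xs j - xs i)) * (F α β γ X Z / X ^ b) *
    ∏ i, ((X * xs i - x) / zs i ^ ((i : ℕ) + 2) * F α β γ (x / xs i) (z / zs i))

/-- The integrand is integrable over the positively oriented product contour
`∏_i {|x_i| = ρ_i} × ∏_i {|z_i| = σ_i}`, the series of `Φ_b(x, z)` converges absolutely, and
`Φ_b(x, z) = (2πi)^{-2(b-1)} ∫ (integrand) ∏ dx_i dz_i` over this contour. -/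
def ContourFormula (α β γ : ℕ+) (b : ℕ) (ρ σ : Fin (b - 1) → ℝ) (x z : ℂ) : Prop :=
  TorusIntegrable (integrand α β γ b x z) 0 (Fin.append ρ σ) ∧
  Summable (fun p : ℕ × ℕ => PhiFactor b x z * PhiTerm α β γ b x z p) ∧
  Phi α β γ b x z =
    1 / (2 * (Real.pi : ℂ) * Complex.I) ^ (2 * (b - 1)) *
      torusIntegral (integrand α β γ b x z) 0 (Fin.append ρ σ)

end

end SchurMZV

/-! ### Truncated sums: peeling off the smallest or the largest summation variable. -/

namespace SchurMZV

/-! Put n = b - 1. The proof has an algebraic half, a Jacobi–Trudi formula, and an analytic half, a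
residue computation.

Algebraic half (`R_eq_det`): the value R^{(a)}_{a+b+c,b} is the determinant of the values
ζ^∗({α}^{a+j}, β, {γ}^{c+n-i}), 0 ≤ i, j ≤ n. For sums truncated at M this is an exact identity
(`tableauSum_eq_det`). Entries depend only on the content of a cell, so removing the cells filled
with the largest integer and expanding the determinant by multilinearity give the same recursion in
M; the surplus terms of the determinant vanish. The identity survives regularization because
expansions in log M + γ_E are unique and compatible with sums and products. Moreover the stuffle
regularization of k is exactly the polynomial in the expansion of the truncated sum
(`hasLogExpansion_truncMZV`): truncated sums obey the stuffle product, and z₁ ∗ w determines the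
value at w z₁.

Analytic half (`contourFormula_succ`): since X x_i - x = X (x_i - x/X), the polynomial factors of
the integrand form, up to a power of X, the Vandermonde determinant at x/X, x_2, …, x_b. Its Leibniz
expansion times the series of the b factors F turns the integrand into an absolutely convergent
series of Laurent monomials on the torus. Only monomials with every exponent equal to -1 contribute.
This forces the F-exponents to be (a + τ(q), c + n - q), q = 0, …, n, for a permutation τ and some
a, c ≥ 0. The surviving terms are therefore those of the Leibniz expansions of the Jacobi–Trudi
determinants.

Convergence near the origin comes from the exponential bound |ζ^∗(k)| ≤ 2 · 16^d for words of length
d (`abs_regMZV_le`). It is proved first for admissible words and then by induction on the number of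
trailing ones. -/

/-- The truncated multiple zeta value with summation variables in `{N + 1, …, N + M}`. -/
noncomputable def shiftedMZV (k : List ℕ+) (N M : ℕ) : ℝ :=
  open scoped Classical in
  ∑ m : Fin k.length → Fin M with StrictMono m,
    ∏ i, (((N + (m i : ℕ) : ℕ) + 1 : ℝ) ^ (k.get i : ℕ))⁻¹

theorem truncMZV_eq_shiftedMZV (k : List ℕ+) (M : ℕ) : truncMZV k M = shiftedMZV k 0 M := by
  simp [truncMZV, shiftedMZV]

@[simp]
theorem shiftedMZV_nil (N M : ℕ) : shiftedMZV [] N M = 1 := by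
  classical
  have : ∀ m : Fin ([] : List ℕ+).length → Fin M, StrictMono m := fun m i => i.elim0
  simp [shiftedMZV, Finset.filter_true_of_mem (fun m _ => this m)]

@[simp]
theorem shiftedMZV_cons_zero (a : ℕ+) (k : List ℕ+) (N : ℕ) : shiftedMZV (a :: k) N 0 = 0 := by
  classical
  refine Finset.sum_eq_zero fun m _ => ?_
  exact (m ⟨0, by simp⟩).elim0

/-- The sum splits according to whether the smallest variable equals N + 1. Moving the lower end of
the range is what requires the shift N. -/
theorem shiftedMZV_cons_succ (a : ℕ+) (k : List ℕ+) (N M : ℕ) :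
    shiftedMZV (a :: k) N (M + 1) = shiftedMZV (a :: k) (N + 1) M +
      ((N + 1 : ℝ) ^ (a : ℕ))⁻¹ * shiftedMZV k (N + 1) M := by
  classical
  unfold shiftedMZV
  rw [← Finset.sum_filter_add_sum_filter_not _ (fun m => m ⟨0, by simp⟩ ≠ 0)]
  congr 1
  · symm
    refine Finset.sum_bij (fun m _ i => (m i).succ) ?_ ?_ ?_ ?_
    · intro m hm
      simp only [Finset.mem_filter, Finset.mem_univ, true_and] at hm ⊢
      exact ⟨fun i j h => Fin.succ_lt_succ_iff.2 (hm h), Fin.succ_ne_zero _⟩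
    · intro m _ m' _ h
      funext i
      exact Fin.succ_injective _ (congrFun h i)
    · intro m hm
      simp only [Finset.mem_filter, Finset.mem_univ, true_and] at hm
      have h0 : ∀ i, m i ≠ 0 := fun i h =>
        hm.2 (Fin.le_zero_iff.1 (h ▸ hm.1.monotone (Fin.mk_le_of_le_val (Nat.zero_le _))))
      refine ⟨fun i => (m i).pred (h0 i), ?_, ?_⟩
      · simp only [Finset.mem_filter, Finset.mem_univ, true_and]
        exact fun i j h => Fin.pred_lt_pred_iff.2 (hm.1 h)
      · funext i; simp
    · intro m _
      refine Finset.prod_congr rfl fun i _ => ?_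
      simp only [Fin.val_succ]
      push_cast
      ring_nf
  · rw [Finset.mul_sum]
    symm
    refine Finset.sum_bij
      (fun m _ => (Fin.cons 0 (fun i => (m i).succ) : Fin (k.length + 1) → Fin (M + 1))) ?_ ?_ ?_ ?_
    · intro m hm
      simp only [Finset.mem_filter, Finset.mem_univ, true_and] at hm ⊢
      refine ⟨?_, by simp⟩
      intro i j h
      induction i using Fin.cases with
      | zero =>
        induction j using Fin.cases with
        | zero => exact absurd h (lt_irrefl _)
        | succ j => simp [Fin.cons_succ, Fin.cons_zero]
      | succ i =>
        induction j using Fin.cases with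
        | zero => exact absurd h (Fin.not_lt_zero _)
        | succ j =>
          simpa [Fin.cons_succ] using hm (Fin.succ_lt_succ_iff.1 h)
    · intro m _ m' _ h
      funext i
      have := congrFun h i.succ
      simpa [Fin.cons_succ] using this
    · intro m hm
      simp only [Finset.mem_filter, Finset.mem_univ, true_and, not_not] at hm
      have hs : StrictMono (m : Fin (k.length + 1) → Fin (M + 1)) := hm.1
      have hz : (m : Fin (k.length + 1) → Fin (M + 1)) 0 = 0 := hm.2
      have h0 : ∀ i : Fin k.length, (m : Fin (k.length + 1) → Fin (M + 1)) i.succ ≠ 0 := fun i h =>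
        absurd (hs (Fin.succ_pos i)) (by rw [h, hz]; exact lt_irrefl _)
      refine ⟨fun i => Fin.pred _ (h0 i), ?_, ?_⟩
      · simp only [Finset.mem_filter, Finset.mem_univ, true_and]
        exact fun i j h => Fin.pred_lt_pred_iff.2 (hs (Fin.succ_lt_succ_iff.2 h))
      · funext i
        induction i using Fin.cases with
        | zero => simp only [Fin.cons_zero]; exact hz.symm
        | succ i => simp only [Fin.cons_succ, Fin.succ_pred]
    · intro m _
      refine Eq.trans ?_ (Fin.prod_univ_succ (n := k.length) _).symm
      refine congrArg₂ (· * ·) (by simp) (Finset.prod_congr rfl fun i _ => ?_)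
      simp only [Fin.cons_succ, Fin.val_succ, List.get_eq_getElem, List.getElem_cons_succ]
      push_cast
      ring_nf

theorem shiftedMZV_nonneg (k : List ℕ+) (N M : ℕ) : 0 ≤ shiftedMZV k N M := by
  classical
  exact Finset.sum_nonneg fun m _ => Finset.prod_nonneg fun i _ => by positivity

theorem truncMZV_nonneg (k : List ℕ+) (M : ℕ) : 0 ≤ truncMZV k M := by
  rw [truncMZV_eq_shiftedMZV]; exact shiftedMZV_nonneg _ _ _

theorem shiftedMZV_append_singleton_succ (k : List ℕ+) (a : ℕ+) (N M : ℕ) :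
    shiftedMZV (k ++ [a]) N (M + 1) = shiftedMZV (k ++ [a]) N M +
      ((N + M + 1 : ℝ) ^ (a : ℕ))⁻¹ * shiftedMZV k N M := by
  induction M generalizing N k with
  | zero =>
    cases k with
    | nil => simp [shiftedMZV_cons_succ]
    | cons c k =>
      cases k <;> simp [shiftedMZV_cons_succ]
  | succ M ih =>
    cases k with
    | nil =>
      have h := ih [] (N + 1)
      simp only [List.nil_append, shiftedMZV_nil] at h ⊢
      rw [shiftedMZV_cons_succ, h, shiftedMZV_cons_succ a [] N M]
      simp only [shiftedMZV_nil]
      push_cast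
      ring_nf
    | cons c k =>
      have h1 := ih (c :: k) (N + 1)
      have h2 := ih k (N + 1)
      simp only [List.cons_append] at h1 ⊢
      rw [shiftedMZV_cons_succ, h1, h2, shiftedMZV_cons_succ c (k ++ [a]) N M,
        shiftedMZV_cons_succ c k N M]
      push_cast
      ring_nf

@[simp]
theorem truncMZV_nil (M : ℕ) : truncMZV [] M = 1 := by
  simp [truncMZV_eq_shiftedMZV]

theorem truncMZV_zero {k : List ℕ+} (hk : k ≠ []) : truncMZV k 0 = 0 := by
  obtain ⟨a, k, rfl⟩ := List.exists_cons_of_ne_nil hk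
  simp [truncMZV_eq_shiftedMZV]

theorem truncMZV_append_singleton_succ (k : List ℕ+) (a : ℕ+) (M : ℕ) :
    truncMZV (k ++ [a]) (M + 1) =
      truncMZV (k ++ [a]) M + ((M + 1 : ℝ) ^ (a : ℕ))⁻¹ * truncMZV k M := by
  simp only [truncMZV_eq_shiftedMZV, shiftedMZV_append_singleton_succ, Nat.cast_zero, zero_add]

/-! ### The stuffle product of truncated values -/

theorem sum_map_cons_zero (a : ℕ+) (L : List (List ℕ+)) (N : ℕ) :
    ((L.map (List.cons a)).map (fun w => shiftedMZV w N 0)).sum = 0 := by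
  induction L with
  | nil => simp
  | cons w L ih => simpa using ih

theorem sum_map_cons_succ (a : ℕ+) (L : List (List ℕ+)) (N M : ℕ) :
    ((L.map (List.cons a)).map (fun w => shiftedMZV w N (M + 1))).sum =
      ((L.map (List.cons a)).map (fun w => shiftedMZV w (N + 1) M)).sum +
        ((N + 1 : ℝ) ^ (a : ℕ))⁻¹ * (L.map (fun w => shiftedMZV w (N + 1) M)).sum := by
  induction L with
  | nil => simp
  | cons w L ih =>
    simp only [List.map_cons, List.sum_cons, ih, shiftedMZV_cons_succ]
    ring

/-- The stuffle recursion acts on first letters, hence on the smallest variables. With N + 1 peeled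
off both factors, the four products are the words avoiding N + 1 and the three ways in which a, b or
both use it. -/
theorem shiftedMZV_mul (u v : List ℕ+) (N M : ℕ) :
    shiftedMZV u N M * shiftedMZV v N M =
      ((stuffle u v).map (fun w => shiftedMZV w N M)).sum := by
  induction M generalizing u v N with
  | zero =>
    rcases u with _ | ⟨a, u⟩
    · simp [stuffle]
    rcases v with _ | ⟨b, v⟩
    · simp [stuffle]
    · simp only [stuffle, List.map_append, List.sum_append, sum_map_cons_zero]
      simp
  | succ M ih =>
    rcases u with _ | ⟨a, u⟩
    · simp [stuffle]
    rcases v with _ | ⟨b, v⟩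
    · simp [stuffle]
    · have h := ih (a :: u) (b :: v) (N + 1)
      simp only [stuffle, List.map_append, List.sum_append, sum_map_cons_succ] at h ⊢
      rw [← ih, ← ih, ← ih, shiftedMZV_cons_succ, shiftedMZV_cons_succ b]
      have hp : ((N + 1 : ℝ) ^ ((a + b : ℕ+) : ℕ))⁻¹ =
          ((N + 1 : ℝ) ^ (a : ℕ))⁻¹ * ((N + 1 : ℝ) ^ (b : ℕ))⁻¹ := by
        rw [PNat.add_coe, pow_add, mul_inv]
      rw [hp]
      linear_combination h

theorem truncMZV_mul (u v : List ℕ+) (M : ℕ) :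
    truncMZV u M * truncMZV v M = ((stuffle u v).map (fun w => truncMZV w M)).sum := by
  simp only [truncMZV_eq_shiftedMZV, shiftedMZV_mul]

/-! ### Stuffle products with `z₁` -/

/-- The words `v z_a z₁^j` with `a ≥ 2` and `j ≤ c`. -/
def TrailingOnesLE (c : ℕ) (w : List ℕ+) : Prop :=
  ∃ v a j, 2 ≤ a ∧ j ≤ c ∧ w = v ++ a :: List.replicate j 1

theorem TrailingOnesLE.cons {c : ℕ} {w : List ℕ+} (h : TrailingOnesLE c w) (b : ℕ+) :
    TrailingOnesLE c (b :: w) := by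
  obtain ⟨v, a, j, ha, hj, rfl⟩ := h
  exact ⟨b :: v, a, j, ha, hj, rfl⟩

theorem TrailingOnesLE.mono {c c' : ℕ} {w : List ℕ+} (h : TrailingOnesLE c w) (hc : c ≤ c') :
    TrailingOnesLE c' w := by
  obtain ⟨v, a, j, ha, hj, rfl⟩ := h
  exact ⟨v, a, j, ha, hj.trans hc, rfl⟩

theorem TrailingOnesLE.admissible {w : List ℕ+} (h : TrailingOnesLE 0 w) : Admissible w := by
  obtain ⟨v, a, j, ha, hj, rfl⟩ := h
  obtain rfl : j = 0 := by omega
  intro x hx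
  simp at hx
  exact hx ▸ ha

theorem two_le_one_add (a : ℕ+) : 2 ≤ 1 + a := by
  have h : 1 ≤ a := one_le
  rw [← PNat.coe_le_coe] at h ⊢
  simp only [PNat.add_coe, PNat.one_coe] at h ⊢
  change 2 ≤ _
  omega

theorem trailingOnesLE_or (w : List ℕ+) :
    (∃ c, w = List.replicate c 1) ∨ ∃ c, TrailingOnesLE c w := by
  induction w with
  | nil => exact Or.inl ⟨0, rfl⟩
  | cons b w ih =>
    rcases ih with ⟨c, rfl⟩ | ⟨c, h⟩
    · by_cases hb : b = 1
      · exact Or.inl ⟨c + 1, by rw [hb, List.replicate_succ]⟩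
      · refine Or.inr ⟨c, [], b, c, ?_, le_rfl, rfl⟩
        have : 1 < b := lt_of_le_of_ne one_le (Ne.symm hb)
        exact this
    · exact Or.inr ⟨c, h.cons b⟩

theorem stuffle_one_cons (b : ℕ+) (v : List ℕ+) :
    stuffle [1] (b :: v) = (1 :: b :: v) :: ((stuffle [1] v).map (List.cons b) ++ [(1 + b) :: v]) := by
  simp [stuffle]

/-- The length and trailing-ones constraints on the words of `z₁ ∗ w` other than `w z₁`. -/
structure IsRemainder (w : List ℕ+) (c : ℕ) (L : List (List ℕ+)) : Prop where
  length_le : L.length ≤ 2 * w.length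
  trailing : ∀ l ∈ L, TrailingOnesLE c l
  length_word_le : ∀ l ∈ L, l.length ≤ w.length + 1

theorem IsRemainder.cons {w : List ℕ+} {c : ℕ} {L : List (List ℕ+)} (h : IsRemainder w c L)
    {b : ℕ+} {L' : List (List ℕ+)} (hL' : L'.length ≤ 2) (ht : ∀ l ∈ L', TrailingOnesLE c l)
    (hl : ∀ l ∈ L', l.length ≤ w.length + 2) :
    IsRemainder (b :: w) c (L' ++ L.map (List.cons b)) where
  length_le := by
    have := h.length_le
    simp only [List.length_append, List.length_map, List.length_cons]
    omega
  trailing l hl' := by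
    rcases List.mem_append.1 hl' with hl' | hl'
    · exact ht l hl'
    · obtain ⟨l', hm, rfl⟩ := List.mem_map.1 hl'
      exact (h.trailing l' hm).cons b
  length_word_le l hl' := by
    rcases List.mem_append.1 hl' with hl' | hl'
    · exact (hl l hl').trans (by simp)
    · obtain ⟨l', hm, rfl⟩ := List.mem_map.1 hl'
      simpa using h.length_word_le l' hm

theorem IsRemainder.mono {w : List ℕ+} {c c' : ℕ} {L : List (List ℕ+)} (h : IsRemainder w c L)
    (hc : c ≤ c') : IsRemainder w c' L :=
  ⟨h.length_le, fun l hl => (h.trailing l hl).mono hc, h.length_word_le⟩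

theorem stuffle_one_replicate (c : ℕ) : ∃ L, IsRemainder (List.replicate c 1) c L ∧
    (stuffle [1] (List.replicate c 1)).Perm
      (List.replicate (c + 1) (List.replicate (c + 1) 1) ++ L) := by
  induction c with
  | zero => exact ⟨[], ⟨by simp, by simp, by simp⟩, by simp [stuffle]⟩
  | succ c ih =>
    obtain ⟨L, hL, hp⟩ := ih
    refine ⟨[(1 + 1) :: List.replicate c 1] ++ L.map (List.cons 1), ?_, ?_⟩
    · rw [List.replicate_succ]
      refine (hL.mono (Nat.le_succ c)).cons (by simp) ?_ (by simp)
      simp only [List.mem_singleton, forall_eq]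
      exact ⟨[], 1 + 1, c, two_le_one_add 1, by omega, rfl⟩
    · rw [List.replicate_succ (n := c), stuffle_one_cons]
      have h1 := hp.map (List.cons 1)
      rw [List.map_append, List.map_replicate, ← List.replicate_succ (n := c + 1)] at h1
      rw [List.replicate_succ (n := c + 1), List.cons_append, ← List.replicate_succ (n := c),
        ← List.replicate_succ (n := c + 1)]
      refine List.Perm.cons _ ?_
      refine (List.perm_append_comm).trans ?_
      refine (List.Perm.append_left _ h1).trans ?_
      exact List.perm_append_comm_assoc _ _ _

/-- The letter 1 can enter the final block of c ones at c + 1 places, each giving the same word. Any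
other insertion leaves that block unchanged, and a merger creates a letter at least 2, so no
remaining word has more than c trailing ones. -/
theorem stuffle_one_of_two_le (v : List ℕ+) (a : ℕ+) (c : ℕ) (ha : 2 ≤ a) :
    ∃ L, IsRemainder (v ++ a :: List.replicate c 1) c L ∧
      (stuffle [1] (v ++ a :: List.replicate c 1)).Perm
        (List.replicate (c + 1) (v ++ a :: List.replicate (c + 1) 1) ++ L) := by
  have ha' : 2 ≤ 1 + a := two_le_one_add a
  have key : ∀ (b : ℕ+) (w W : List ℕ+) (L : List (List ℕ+)),
      (stuffle [1] w).Perm (List.replicate (c + 1) W ++ L) →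
      (stuffle [1] (b :: w)).Perm (List.replicate (c + 1) (b :: W) ++
        ([1 :: b :: w, (1 + b) :: w] ++ L.map (List.cons b))) := by
    intro b w W L h
    rw [stuffle_one_cons]
    have h1 := h.map (List.cons b)
    rw [List.map_append, List.map_replicate] at h1
    refine List.Perm.trans ?_ (List.perm_append_comm_assoc _ _ _)
    rw [List.cons_append]
    refine List.Perm.cons _ ?_
    exact (List.perm_append_comm).trans (List.Perm.append_left _ h1)
  induction v with
  | nil =>
    obtain ⟨L, hL, hp⟩ := stuffle_one_replicate c
    refine ⟨_, hL.cons (b := a) (L' := [1 :: a :: List.replicate c 1, (1 + a) :: List.replicate c 1])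
      (by simp) ?_ (by simp), key a _ _ L hp⟩
    simp only [List.mem_cons, List.not_mem_nil, or_false, forall_eq_or_imp, forall_eq]
    exact ⟨⟨[1], a, c, ha, le_rfl, rfl⟩, ⟨[], 1 + a, c, ha', le_rfl, rfl⟩⟩
  | cons b v ih =>
    obtain ⟨L, hL, hp⟩ := ih
    refine ⟨_, hL.cons (b := b) (L' := [1 :: b :: (v ++ a :: List.replicate c 1),
      (1 + b) :: (v ++ a :: List.replicate c 1)]) (by simp) ?_ (by simp), key b _ _ L hp⟩
    simp only [List.mem_cons, List.not_mem_nil, or_false, forall_eq_or_imp, forall_eq]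
    exact ⟨⟨1 :: b :: v, a, c, ha, le_rfl, rfl⟩, ⟨(1 + b) :: v, a, c, ha, le_rfl, rfl⟩⟩

/-- Induction on the number of trailing ones. In z₁ ∗ w all words other than w z₁ have at most c of
them after a letter at least 2, so a property of w z₁ can be derived from w and these words. The
index of P lets quantitative bounds depend on c. -/
theorem append_singleton_induction {P : ℕ → List ℕ+ → Prop}
    (mono : ∀ c w, P c w → P (c + 1) w)
    (adm : ∀ w, Admissible w → P 0 w)
    (step : ∀ w c L, IsRemainder w c L →
      (stuffle [1] w).Perm (List.replicate (c + 1) (w ++ [1]) ++ L) →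
      P c w → (∀ l ∈ L, P c l) → P (c + 1) (w ++ [1])) (c : ℕ) :
    P c (List.replicate c 1) ∧ ∀ w, TrailingOnesLE c w → P c w := by
  induction c with
  | zero => exact ⟨adm _ (by simp [Admissible]), fun w h => adm w h.admissible⟩
  | succ c ih =>
    refine ⟨?_, ?_⟩
    · obtain ⟨L, hL, hp⟩ := stuffle_one_replicate c
      have hw : List.replicate (c + 1) (1 : ℕ+) = List.replicate c 1 ++ [1] := List.replicate_succ'
      rw [hw] at hp ⊢
      exact step _ c L hL hp ih.1 fun l hl => ih.2 l (hL.trailing l hl)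
    · rintro w ⟨v, a, j, ha, hj, rfl⟩
      rcases hj.lt_or_eq with hj | rfl
      · exact mono _ _ (ih.2 _ ⟨v, a, j, ha, by omega, rfl⟩)
      · obtain ⟨L, hL, hp⟩ := stuffle_one_of_two_le v a c ha
        have hw : v ++ a :: List.replicate (c + 1) 1 = (v ++ a :: List.replicate c 1) ++ [1] := by
          rw [List.replicate_succ', List.append_assoc, List.cons_append]
        rw [hw] at hp ⊢
        exact step _ c L hL hp (ih.2 _ ⟨v, a, c, ha, le_rfl, rfl⟩)
          fun l hl => ih.2 l (hL.trailing l hl)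

end SchurMZV

namespace SchurMZV
open Filter Asymptotics Topology

/-! ### Asymptotic expansions in `log M` -/

/-- `f M = P(log M + γ) + O(log^J M / M)` for some `J > 0`. -/
def HasLogExpansion (f : ℕ → ℝ) (P : Polynomial ℝ) : Prop :=
  ∃ J : ℕ, 0 < J ∧
    (fun M : ℕ => f M - P.eval (Real.log M + Real.eulerMascheroniConstant))
      =O[atTop] (fun M : ℕ => Real.log M ^ J / M)

theorem eventually_one_le_log : ∀ᶠ M : ℕ in atTop, 1 ≤ Real.log M := by
  have := Real.tendsto_log_atTop.comp (tendsto_natCast_atTop_atTop (R := ℝ))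
  exact this.eventually_ge_atTop 1

theorem isBigO_log_pow_div_of_le {J J' : ℕ} (h : J ≤ J') :
    (fun M : ℕ => Real.log M ^ J / M) =O[atTop] (fun M : ℕ => Real.log M ^ J' / M) := by
  refine IsBigO.of_bound 1 ?_
  filter_upwards [eventually_one_le_log] with M hM
  rw [one_mul, norm_div, norm_div, norm_pow, norm_pow]
  gcongr
  rw [Real.norm_eq_abs]
  exact hM.trans (le_abs_self _)

theorem tendsto_log_pow_div (J : ℕ) :
    Tendsto (fun M : ℕ => Real.log M ^ J / M) atTop (𝓝 0) := by
  have := (Real.isLittleO_pow_log_id_atTop (n := J)).tendsto_div_nhds_zero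
  exact this.comp tendsto_natCast_atTop_atTop

theorem tendsto_log_add_euler :
    Tendsto (fun M : ℕ => Real.log M + Real.eulerMascheroniConstant) atTop atTop :=
  tendsto_atTop_add_const_right _ _
    (Real.tendsto_log_atTop.comp (tendsto_natCast_atTop_atTop (R := ℝ)))

/-- The requirement 0 < J costs nothing: log M is eventually at least 1, so the exponent may be
raised. -/
theorem HasLogExpansion.mk {f : ℕ → ℝ} {P : Polynomial ℝ} (J : ℕ)
    (h : (fun M : ℕ => f M - P.eval (Real.log M + Real.eulerMascheroniConstant))
      =O[atTop] (fun M : ℕ => Real.log M ^ J / M)) : HasLogExpansion f P :=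
  ⟨J + 1, J.succ_pos, h.trans (isBigO_log_pow_div_of_le J.le_succ)⟩

/-- Both errors tend to 0, so P - Q tends to 0 along a sequence going to infinity, which only the
zero polynomial does. -/
theorem HasLogExpansion.unique {f : ℕ → ℝ} {P Q : Polynomial ℝ} (hP : HasLogExpansion f P)
    (hQ : HasLogExpansion f Q) : P = Q := by
  obtain ⟨J, _, hJ⟩ := hP
  obtain ⟨J', _, hJ'⟩ := hQ
  have h1 := hJ.trans_tendsto (tendsto_log_pow_div J)
  have h2 := hJ'.trans_tendsto (tendsto_log_pow_div J')
  have h3 : Tendsto (fun M : ℕ =>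
      (P - Q).eval (Real.log M + Real.eulerMascheroniConstant)) atTop (𝓝 0) := by
    have := h2.sub h1
    simp only [sub_zero] at this
    refine this.congr fun M => ?_
    rw [Polynomial.eval_sub]; ring
  by_cases hd : 0 < (P - Q).degree
  · have h4 := ((P - Q).abs_tendsto_atTop hd).comp tendsto_log_add_euler
    have h5 := h3.abs
    exact absurd h5 (not_tendsto_nhds_of_tendsto_atTop h4 _)
  · rw [not_lt, Polynomial.degree_le_zero_iff] at hd
    rw [hd] at h3
    simp only [Polynomial.eval_C] at h3
    have := tendsto_nhds_unique h3 tendsto_const_nhds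
    rw [← this, Polynomial.C_0] at hd
    exact sub_eq_zero.1 hd

theorem hasLogExpansion_C (r : ℝ) : HasLogExpansion (fun _ => r) (Polynomial.C r) :=
  .mk 0 (by simpa using isBigO_zero _ _)

theorem HasLogExpansion.add {f g : ℕ → ℝ} {P Q : Polynomial ℝ} (hP : HasLogExpansion f P)
    (hQ : HasLogExpansion g Q) : HasLogExpansion (fun M => f M + g M) (P + Q) := by
  obtain ⟨J, _, hJ⟩ := hP
  obtain ⟨J', _, hJ'⟩ := hQ
  refine .mk (max J J') ?_
  have := (hJ.trans (isBigO_log_pow_div_of_le (le_max_left J J'))).add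
    (hJ'.trans (isBigO_log_pow_div_of_le (le_max_right J J')))
  refine this.congr_left fun M => ?_
  rw [Polynomial.eval_add]; ring

theorem eval_isBigO_log_pow (P : Polynomial ℝ) : ∃ d : ℕ,
    (fun M : ℕ => P.eval (Real.log M + Real.eulerMascheroniConstant))
      =O[atTop] (fun M : ℕ => Real.log M ^ d) := by
  refine ⟨P.natDegree, ?_⟩
  have h1 : (fun x => P.eval x) =O[atTop] (fun x => (Polynomial.X ^ P.natDegree : Polynomial ℝ).eval x) :=
    Polynomial.isBigO_atTop_of_degree_le _ _ (by rw [Polynomial.degree_X_pow]; exact P.degree_le_natDegree)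
  refine (h1.comp_tendsto tendsto_log_add_euler).trans ?_
  simp only [Function.comp_def, Polynomial.eval_pow, Polynomial.eval_X]
  refine IsBigO.pow ?_ _
  refine (isBigO_refl _ _).add (IsBigO.of_bound |Real.eulerMascheroniConstant| ?_)
  filter_upwards [eventually_one_le_log] with M hM
  rw [Real.norm_eq_abs, Real.norm_eq_abs]
  exact le_mul_of_one_le_right (abs_nonneg _) (hM.trans (le_abs_self _))

/-- The error is (f - P)(g - Q) + (f - P)Q + (g - Q)P, and polynomials in log M only raise the power
of the logarithm. -/
theorem HasLogExpansion.mul {f g : ℕ → ℝ} {P Q : Polynomial ℝ} (hP : HasLogExpansion f P)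
    (hQ : HasLogExpansion g Q) : HasLogExpansion (fun M => f M * g M) (P * Q) := by
  obtain ⟨J, _, hJ⟩ := hP
  obtain ⟨J', _, hJ'⟩ := hQ
  obtain ⟨d, hd⟩ := eval_isBigO_log_pow P
  obtain ⟨d', hd'⟩ := eval_isBigO_log_pow Q
  refine .mk (J + J' + d + d') ?_
  have e1 : (fun M : ℕ => Real.log M ^ J / M * (Real.log M ^ J' / M)) =O[atTop]
      (fun M : ℕ => Real.log M ^ (J + J') / M) := by
    refine IsBigO.of_bound 1 ?_
    filter_upwards [eventually_ge_atTop 1] with M hM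
    have hM' : (1 : ℝ) ≤ M := by exact_mod_cast hM
    rw [one_mul, div_mul_div_comm, ← pow_add, norm_div, norm_div, norm_mul]
    have : (1 : ℝ) ≤ ‖(M : ℝ)‖ := hM'.trans (le_abs_self _)
    gcongr
    exact le_mul_of_one_le_left (norm_nonneg _) this
  have t1 := ((hJ.mul hJ').trans e1).trans
    (isBigO_log_pow_div_of_le (show J + J' ≤ J + J' + d + d' by omega))
  have t2 := (hJ.mul hd').trans (((isBigO_refl _ _).congr_left (fun M => by
    rw [pow_add]; ring)).trans (isBigO_log_pow_div_of_le (show J + d' ≤ J + J' + d + d' by omega)))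
  have t3 := (hJ'.mul hd).trans (((isBigO_refl _ _).congr_left (fun M => by
    rw [pow_add]; ring)).trans (isBigO_log_pow_div_of_le (show J' + d ≤ J + J' + d + d' by omega)))
  refine ((t1.add t2).add t3).congr_left fun M => ?_
  rw [Polynomial.eval_mul]
  ring

theorem HasLogExpansion.const_mul {f : ℕ → ℝ} {P : Polynomial ℝ} (hP : HasLogExpansion f P)
    (r : ℝ) : HasLogExpansion (fun M => r * f M) (Polynomial.C r * P) :=
  (hasLogExpansion_C r).mul hP

theorem HasLogExpansion.list_sum {ι : Type*} (L : List ι) {f : ι → ℕ → ℝ} {P : ι → Polynomial ℝ}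
    (h : ∀ i ∈ L, HasLogExpansion (f i) (P i)) :
    HasLogExpansion (fun M => (L.map (fun i => f i M)).sum) (L.map P).sum := by
  induction L with
  | nil => simpa using hasLogExpansion_C 0
  | cons i L ih =>
    simp only [List.map_cons, List.sum_cons]
    exact (h i (by simp)).add (ih fun j hj => h j (by simp [hj]))

theorem HasLogExpansion.sum {ι : Type*} (s : Finset ι) {f : ι → ℕ → ℝ} {P : ι → Polynomial ℝ}
    (h : ∀ i ∈ s, HasLogExpansion (f i) (P i)) :
    HasLogExpansion (fun M => ∑ i ∈ s, f i M) (∑ i ∈ s, P i) := by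
  have := HasLogExpansion.list_sum s.toList (f := f) (P := P) (fun i hi => h i (by simpa using hi))
  simpa using this

theorem HasLogExpansion.prod {ι : Type*} (s : Finset ι) {f : ι → ℕ → ℝ} {P : ι → Polynomial ℝ}
    (h : ∀ i ∈ s, HasLogExpansion (f i) (P i)) :
    HasLogExpansion (fun M => ∏ i ∈ s, f i M) (∏ i ∈ s, P i) := by
  classical
  induction s using Finset.induction_on with
  | empty => simpa using hasLogExpansion_C 1
  | insert i s hi ih =>
    simp only [Finset.prod_insert hi]
    exact (h i (by simp)).mul (ih fun j hj => h j (by simp [hj]))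

theorem HasLogExpansion.det {ι : Type*} [Fintype ι] [DecidableEq ι] {A : ℕ → Matrix ι ι ℝ}
    {P : Matrix ι ι (Polynomial ℝ)} (h : ∀ i j, HasLogExpansion (fun M => A M i j) (P i j)) :
    HasLogExpansion (fun M => (A M).det) P.det := by
  simp only [Matrix.det_apply']
  refine HasLogExpansion.sum _ fun τ _ => ?_
  have h1 := HasLogExpansion.prod Finset.univ (f := fun i M => A M (τ i) i)
    (P := fun i => P (τ i) i) fun i _ => h _ _
  have h2 := h1.const_mul (((Equiv.Perm.sign τ : ℤ)) : ℝ)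
  simpa using h2

/-! ### Harmonic numbers and tails -/

theorem truncMZV_one (M : ℕ) : truncMZV [1] M = harmonic M := by
  induction M with
  | zero => simp [truncMZV_zero]
  | succ M ih =>
    have := truncMZV_append_singleton_succ [] 1 M
    simp only [List.nil_append] at this
    rw [this, ih, harmonic_succ]
    simp

theorem hasLogExpansion_truncMZV_one : HasLogExpansion (truncMZV [1]) Polynomial.X := by
  refine .mk 0 ?_
  refine IsBigO.of_bound 1 ?_
  filter_upwards [eventually_ge_atTop 1] with M hM
  have hM' : (0 : ℝ) < M := by exact_mod_cast hM
  have h1 := Real.eulerMascheroniSeq_lt_eulerMascheroniConstant M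
  have h2 := Real.eulerMascheroniConstant_lt_eulerMascheroniSeq' M
  rw [Real.eulerMascheroniSeq] at h1
  rw [Real.eulerMascheroniSeq', if_neg (by omega)] at h2
  have h3 : Real.log (M + 1) - Real.log M ≤ 1 / M := by
    rw [← Real.log_div (by positivity) hM'.ne']
    refine (Real.log_le_sub_one_of_pos (by positivity)).trans (le_of_eq ?_)
    field_simp
    ring
  rw [Polynomial.eval_X, truncMZV_one, pow_zero, one_mul, Real.norm_eq_abs, Real.norm_eq_abs,
    abs_of_nonneg (by linarith), abs_of_nonneg (by positivity)]
  linarith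

theorem harmonic_cast_succ (M : ℕ) : ((harmonic (M + 1) : ℚ) : ℝ) = harmonic M + (M + 1 : ℝ)⁻¹ := by
  rw [harmonic_succ]; push_cast; ring

theorem harmonic_cast_nonneg (M : ℕ) : (0 : ℝ) ≤ harmonic M := by
  rw [← truncMZV_one]; exact truncMZV_nonneg _ _

theorem truncMZV_le_harmonic_pow (k : List ℕ+) (M : ℕ) :
    truncMZV k M ≤ (harmonic M : ℝ) ^ k.length := by
  induction M generalizing k with
  | zero =>
    cases k with
    | nil => simp
    | cons a k => simp [truncMZV_zero]
  | succ M ih =>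
    rcases k.eq_nil_or_concat' with rfl | ⟨k, a, rfl⟩
    · simp
    · rw [truncMZV_append_singleton_succ, harmonic_cast_succ, List.length_append, List.length_singleton,
        pow_succ]
      have h0 := harmonic_cast_nonneg M
      have h1 := ih (k ++ [a])
      have h2 := ih k
      rw [List.length_append, List.length_singleton, pow_succ] at h1
      have h3 : ((M + 1 : ℝ) ^ (a : ℕ))⁻¹ ≤ (M + 1 : ℝ)⁻¹ := by
        gcongr
        exact le_self_pow₀ (by linarith [(Nat.cast_nonneg M : (0 : ℝ) ≤ M)]) a.pos.ne'
      have h4 : ((M + 1 : ℝ) ^ (a : ℕ))⁻¹ * truncMZV k M ≤ (M + 1 : ℝ)⁻¹ * harmonic M ^ k.length :=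
        mul_le_mul h3 h2 (truncMZV_nonneg _ _) (by positivity)
      calc _ ≤ (harmonic M : ℝ) ^ k.length * (harmonic M + (M + 1 : ℝ)⁻¹) := by linarith
        _ ≤ _ := by
          gcongr
          exact le_add_of_nonneg_right (by positivity)

/-- A majorant for the tails of `∑ H_m^l / m²`. -/
theorem exists_tail_majorant (l : ℕ) : ∃ (B : ℕ → ℝ) (C : ℝ), 0 ≤ C ∧
    (∀ M, B M ≤ C * ((harmonic M : ℝ) ^ l / M)) ∧ (∀ M, 0 ≤ B M) ∧
    ∀ M, 1 ≤ M → (harmonic (M + 1) : ℝ) ^ l / ((M : ℝ) + 1) ^ 2 ≤ B M - B (M + 1) := by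
  have key : ∀ M : ℕ, 1 ≤ M → ((M : ℝ) + 1)⁻¹ ^ 2 ≤ (M : ℝ)⁻¹ - ((M : ℝ) + 1)⁻¹ := by
    intro M hM
    have hM' : (0 : ℝ) < M := by exact_mod_cast hM
    rw [inv_sub_inv hM'.ne' (by positivity), inv_pow, inv_eq_one_div, div_le_div_iff₀ (by positivity) (by positivity)]
    nlinarith
  induction l with
  | zero =>
    refine ⟨fun M => (M : ℝ)⁻¹, 1, zero_le_one, fun M => by simp, fun M => by positivity, ?_⟩
    intro M hM
    have := key M hM
    simpa [inv_pow] using this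
  | succ l ih =>
    obtain ⟨B, C, hC, hBC, hB, hs⟩ := ih
    refine ⟨fun M => (harmonic M : ℝ) ^ (l + 1) / M + 2 * (l + 1) * B M, 1 + 2 * (l + 1) * C,
      by positivity, ?_, ?_, ?_⟩
    -- At M = 0 the majorant vanishes because division by zero gives 0, hence B 0 = 0. The
    -- inequality 1 ≤ H_M used otherwise needs M ≥ 1.
    · intro M
      rcases Nat.eq_zero_or_pos M with rfl | hM
      · have := hBC 0
        simp at this
        have h2 := hB 0
        have : B 0 = 0 := le_antisymm this h2
        simp [this]
      · have h1 : (1 : ℝ) ≤ harmonic M := by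
          obtain ⟨M, rfl⟩ := Nat.exists_eq_succ_of_ne_zero hM.ne'
          clear hM
          induction M with
          | zero => simp
          | succ M ih =>
            have := harmonic_cast_succ (M + 1)
            rw [Nat.succ_eq_add_one] at *
            rw [this]
            have : (0 : ℝ) ≤ (((M + 1 : ℕ) : ℝ) + 1)⁻¹ := by positivity
            linarith
        have h2 : (harmonic M : ℝ) ^ l / M ≤ (harmonic M : ℝ) ^ (l + 1) / M := by
          gcongr
          exact l.le_succ
        have h3 := (hBC M).trans (mul_le_mul_of_nonneg_left h2 hC)
        have h4 := mul_le_mul_of_nonneg_left h3 (show (0 : ℝ) ≤ 2 * (l + 1) by positivity)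
        linarith
    · intro M
      have := harmonic_cast_nonneg M
      have := hB M
      positivity
    · intro M hM
      have hM' : (0 : ℝ) < M := by exact_mod_cast hM
      have h0 := harmonic_cast_nonneg M
      have hsucc := harmonic_cast_succ M
      have hs := hs M hM
      have hk := key M hM
      set H := (harmonic M : ℝ)
      set H' := (harmonic (M + 1) : ℝ)
      set y := ((M : ℝ) + 1)⁻¹ with hy
      have hy0 : 0 < y := by positivity
      have hH' : 0 ≤ H' := by rw [hsucc]; positivity
      have hle : H ≤ H' := by linarith
      have hpow : H' ^ (l + 1) - H ^ (l + 1) ≤ (l + 1) * H' ^ l * y := by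
        have := (le_abs_self _).trans (abs_pow_sub_pow_le H' H (l + 1))
        rw [abs_of_nonneg (by linarith), abs_of_nonneg h0, abs_of_nonneg hH', max_eq_left hle,
          show H' - H = y by linarith] at this
        push_cast [Nat.add_sub_cancel] at this
        linarith
      have hMy : (M : ℝ)⁻¹ ≤ 2 * y := by
        rw [hy, inv_eq_one_div, ← div_eq_mul_inv, div_le_div_iff₀ hM' (by positivity)]
        have : (1 : ℝ) ≤ M := by exact_mod_cast hM
        linarith
      have hs' : H' ^ l * y ^ 2 ≤ B M - B (M + 1) := by
        rw [div_eq_mul_inv, ← inv_pow] at hs; exact hs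
      have e1 : H' ^ (l + 1) * y ^ 2 ≤ H' ^ (l + 1) * ((M : ℝ)⁻¹ - y) :=
        mul_le_mul_of_nonneg_left hk (by positivity)
      have e2 : (H' ^ (l + 1) - H ^ (l + 1)) * (M : ℝ)⁻¹ ≤ ((l + 1) * H' ^ l * y) * (2 * y) :=
        mul_le_mul hpow hMy (by positivity) (by positivity)
      have e3 := mul_le_mul_of_nonneg_left hs' (show (0 : ℝ) ≤ 2 * (l + 1) by positivity)
      have hcast : (((M + 1 : ℕ) : ℝ))⁻¹ = y := by push_cast; rfl
      -- Summation by parts: H^{l+1}/M - H'^{l+1}/(M+1) is H'^{l+1}(1/M - y) minus (H'^{l+1} -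
      -- H^{l+1})/M. The first part dominates the target by `e1`; the second is absorbed by 2(l+1)
      -- times the previous majorant, by `e2` and `e3`.
      change _ ≤ (H ^ (l + 1) / M + 2 * (l + 1) * B M) -
        (H' ^ (l + 1) / ((M + 1 : ℕ) : ℝ) + 2 * (l + 1) * B (M + 1))
      rw [div_eq_mul_inv, ← inv_pow, ← hy, div_eq_mul_inv, div_eq_mul_inv, hcast]
      linarith

theorem Admissible.exists_eq {k : List ℕ+} (hk : Admissible k) (h : k ≠ []) :
    ∃ k' a, 2 ≤ a ∧ k = k' ++ [a] := by
  rcases k.eq_nil_or_concat' with rfl | ⟨k', a, rfl⟩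
  · exact absurd rfl h
  · exact ⟨k', a, hk a (by simp), rfl⟩

theorem truncMZV_mono (k : List ℕ+) : Monotone (truncMZV k) := by
  refine monotone_nat_of_le_succ fun M => ?_
  rcases k.eq_nil_or_concat' with rfl | ⟨k, a, rfl⟩
  · simp
  · rw [truncMZV_append_singleton_succ]
    have := truncMZV_nonneg k M
    exact le_add_of_nonneg_right (by positivity)

theorem inv_pow_le_inv_sq {a : ℕ+} (ha : 2 ≤ a) (M : ℕ) :
    ((M + 1 : ℝ) ^ (a : ℕ))⁻¹ ≤ ((M + 1 : ℝ) ^ 2)⁻¹ := by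
  gcongr
  · linarith [(Nat.cast_nonneg M : (0 : ℝ) ≤ M)]
  · exact_mod_cast ha

/-- The truncated sums increase, while their sum with the tail majorant B decreases from M = 1 on.
Hence they converge, and the distance to the limit is at most B M = O(log^J M / M). -/
theorem hasLogExpansion_admissible {k : List ℕ+} (hk : Admissible k) :
    Tendsto (truncMZV k) atTop (𝓝 (mzv k)) ∧
      HasLogExpansion (truncMZV k) (Polynomial.C (mzv k)) := by
  by_cases hnil : k = []
  · subst hnil
    have h : truncMZV [] = fun _ => 1 := funext truncMZV_nil
    have h1 : Tendsto (truncMZV []) atTop (𝓝 1) := by rw [h]; exact tendsto_const_nhds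
    have h2 : mzv [] = 1 := h1.limUnder_eq
    rw [h2]
    exact ⟨h1, by rw [h]; exact hasLogExpansion_C 1⟩
  obtain ⟨k, a, ha, rfl⟩ := hk.exists_eq hnil
  obtain ⟨B, C, hC, hBC, hB, hs⟩ := exists_tail_majorant k.length
  have step : ∀ M, 1 ≤ M → truncMZV (k ++ [a]) (M + 1) + B (M + 1) ≤ truncMZV (k ++ [a]) M + B M := by
    intro M hM
    rw [truncMZV_append_singleton_succ]
    have h1 := hs M hM
    have h2 := (truncMZV_mono k M.le_succ).trans (truncMZV_le_harmonic_pow k (M + 1))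
    have h3 := mul_le_mul (inv_pow_le_inv_sq ha M) h2 (truncMZV_nonneg _ _) (by positivity)
    rw [div_eq_mul_inv, mul_comm] at h1
    linarith
  have anti : ∀ M N, 1 ≤ M → M ≤ N → truncMZV (k ++ [a]) N + B N ≤ truncMZV (k ++ [a]) M + B M := by
    intro M N hM hMN
    induction N, hMN using Nat.le_induction with
    | base => exact le_rfl
    | succ N hN ih => exact (step N (hM.trans hN)).trans ih
  have bdd : BddAbove (Set.range (truncMZV (k ++ [a]))) := by
    refine ⟨truncMZV (k ++ [a]) 1 + B 1, ?_⟩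
    rintro _ ⟨N, rfl⟩
    have h1 := anti 1 (N + 1) le_rfl (by omega)
    have h2 := truncMZV_mono (k ++ [a]) N.le_succ
    have h3 := hB (N + 1)
    have h4 : truncMZV (k ++ [a]) N ≤ truncMZV (k ++ [a]) (N + 1) := h2
    linarith
  have hlim := tendsto_atTop_ciSup (truncMZV_mono (k ++ [a])) bdd
  have hm : mzv (k ++ [a]) = _ := hlim.limUnder_eq
  rw [← hm] at hlim
  refine ⟨hlim, .mk k.length ?_⟩
  have hH : (fun M : ℕ => (harmonic M : ℝ)) =O[atTop] (fun M : ℕ => Real.log M) := by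
    refine IsBigO.of_bound 2 ?_
    filter_upwards [eventually_one_le_log] with M hM
    rw [Real.norm_eq_abs, abs_of_nonneg (harmonic_cast_nonneg M), Real.norm_eq_abs,
      abs_of_nonneg (by linarith)]
    linarith [harmonic_le_one_add_log M]
  have hHM : (fun M : ℕ => (harmonic M : ℝ) ^ k.length / M) =O[atTop]
      (fun M : ℕ => Real.log M ^ k.length / M) := by
    simp only [div_eq_mul_inv]
    exact (hH.pow _).mul (isBigO_refl _ _)
  refine IsBigO.trans ?_ hHM
  refine IsBigO.of_bound C ?_
  filter_upwards [eventually_ge_atTop 1] with M hM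
  rw [Polynomial.eval_C]
  have h1 : truncMZV (k ++ [a]) M ≤ mzv (k ++ [a]) := (truncMZV_mono _).ge_of_tendsto hlim M
  have h2 : mzv (k ++ [a]) ≤ truncMZV (k ++ [a]) M + B M := by
    refine le_of_tendsto hlim ?_
    filter_upwards [eventually_ge_atTop M] with N hN
    linarith [anti M N hM hN, hB N]
  have h0 := harmonic_cast_nonneg M
  rw [Real.norm_eq_abs, Real.norm_eq_abs, abs_of_nonpos (by linarith), abs_of_nonneg (by positivity)]
  linarith [hBC M]

/-! ### Existence and uniqueness of the stuffle regularization -/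

theorem natCast_mul_append_one {R : Type*} [CommRing R] (Z : List ℕ+ → R)
    {w : List ℕ+} {c : ℕ} {L : List (List ℕ+)}
    (hp : (stuffle [1] w).Perm (List.replicate (c + 1) (w ++ [1]) ++ L)) :
    ((stuffle [1] w).map Z).sum = (c + 1 : ℕ) * Z (w ++ [1]) + (L.map Z).sum := by
  rw [(hp.map Z).sum_eq]
  simp

/-- Every word has a polynomial expansion, and each stuffle regularization must agree with it. -/
theorem exists_expansion (k : List ℕ+) : ∃ P, HasLogExpansion (truncMZV k) P ∧
    ∀ Z, IsStuffleRegularization Z → Z k = P := by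
  have key := append_singleton_induction (P := fun _ k => ∃ P, HasLogExpansion (truncMZV k) P ∧
    ∀ Z, IsStuffleRegularization Z → Z k = P) (fun _ _ h => h)
    (fun w hw => ⟨_, (hasLogExpansion_admissible hw).2, fun Z hZ => hZ.admissible w hw⟩) ?_
  · rcases trailingOnesLE_or k with ⟨c, rfl⟩ | ⟨c, h⟩
    · exact (key c).1
    · exact (key c).2 k h
  intro w c L _ hp hw hL
  obtain ⟨P, hP, hZP⟩ := hw
  have hL' : ∀ l, ∃ Q, l ∈ L → HasLogExpansion (truncMZV l) Q ∧
      ∀ Z, IsStuffleRegularization Z → Z l = Q := by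
    intro l
    by_cases hl : l ∈ L
    · obtain ⟨Q, hQ⟩ := hL l hl
      exact ⟨Q, fun _ => hQ⟩
    · exact ⟨0, fun h => absurd h hl⟩
  choose Q hQ using hL'
  have hc : ((c + 1 : ℕ) : ℝ) ≠ 0 := by positivity
  have hCc : Polynomial.C (((c + 1 : ℕ) : ℝ)⁻¹) * ((c + 1 : ℕ) : Polynomial ℝ) = 1 := by
    rw [← Polynomial.C_eq_natCast, ← Polynomial.C_mul, inv_mul_cancel₀ hc, Polynomial.C_1]
  -- The stuffle relation z₁ ∗ w = (c + 1) w z₁ + ∑ L, solved for the value at w z₁.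
  refine ⟨Polynomial.C (((c + 1 : ℕ) : ℝ)⁻¹) * (Polynomial.X * P + Polynomial.C (-1) * (L.map Q).sum),
    ?_, ?_⟩
  · have h1 := ((hasLogExpansion_truncMZV_one.mul hP).add
      ((HasLogExpansion.list_sum L (f := truncMZV) fun l hl => (hQ l hl).1).const_mul (-1))).const_mul
        (((c + 1 : ℕ) : ℝ)⁻¹)
    convert h1 using 2 with M
    rw [truncMZV_mul, natCast_mul_append_one (fun w => truncMZV w M) hp]
    field_simp
    ring
  · intro Z hZ
    have h1 := hZ.mul [1] w
    rw [natCast_mul_append_one Z hp, hZ.one, hZP Z hZ,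
      List.map_congr_left (g := Q) (fun l hl => (hQ l hl).2 Z hZ)] at h1
    rw [h1, map_neg, Polynomial.C_1]
    linear_combination -(Z (w ++ [1])) * hCc

/-- The polynomials in the expansions satisfy the axioms: uniqueness of expansions transports the
stuffle product of the truncated sums to them. -/
theorem exists_isStuffleRegularization : ∃ Z, IsStuffleRegularization Z := by
  choose P hP _ using exists_expansion
  refine ⟨P, fun k hk => (hP k).unique (hasLogExpansion_admissible hk).2,
    (hP _).unique hasLogExpansion_truncMZV_one, fun u v => ?_⟩
  refine ((hP u).mul (hP v)).unique ?_
  have := HasLogExpansion.list_sum (stuffle u v) (f := truncMZV) fun l _ => hP l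
  simpa only [truncMZV_mul] using this

theorem isStuffleRegularization_stuffleReg : IsStuffleRegularization stuffleReg := by
  rw [stuffleReg, dif_pos exists_isStuffleRegularization]
  exact exists_isStuffleRegularization.choose_spec

theorem hasLogExpansion_truncMZV (k : List ℕ+) : HasLogExpansion (truncMZV k) (stuffleReg k) := by
  obtain ⟨P, hP, h⟩ := exists_expansion k
  rwa [h _ isStuffleRegularization_stuffleReg]

theorem schurReg_eq {μ : YoungDiagram} {s : ℕ × ℕ → ℕ+} {P : Polynomial ℝ}
    (h : HasLogExpansion (truncSchurMZV μ s) P) : schurReg μ s = P := by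
  have h' : ∃ P, IsSchurRegularization μ s P := ⟨P, h⟩
  rw [schurReg, dif_pos h']
  exact HasLogExpansion.unique (f := truncSchurMZV μ s) h'.choose_spec h

end SchurMZV

namespace SchurMZV
open Filter Asymptotics Topology

/-! ### Exponential bounds for regularized multiple zeta values -/

/-- The product `∏_{n ≤ M} (1 + 1 / (2 n))`. -/
noncomputable def halfProd (M : ℕ) : ℝ := ∏ n ∈ Finset.range M, (1 + (2 * ((n : ℝ) + 1))⁻¹)

theorem halfProd_succ (M : ℕ) :
    halfProd (M + 1) = halfProd M * (1 + (2 * ((M : ℝ) + 1))⁻¹) :=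
  Finset.prod_range_succ _ _

theorem halfProd_pos (M : ℕ) : 0 < halfProd M :=
  Finset.prod_pos fun n _ => by positivity

/-- The depth-d sum with all entries 1 is the coefficient of t^d in ∏ (1 + t/n), and it dominates
every sum of depth d. Take t = 1/2: the product grows only like √M, slowly enough to be summed
against 1/M². -/
theorem truncMZV_le_halfProd (k : List ℕ+) (M : ℕ) :
    truncMZV k M ≤ 2 ^ k.length * halfProd M := by
  induction M generalizing k with
  | zero =>
    cases k with
    | nil => simp [halfProd]
    | cons a k => simp [truncMZV_zero, halfProd]
  | succ M ih =>
    rcases k.eq_nil_or_concat' with rfl | ⟨k, a, rfl⟩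
    · have h := ih []
      have h0 := halfProd_pos M
      rw [truncMZV_nil, List.length_nil, pow_zero, one_mul] at h ⊢
      rw [halfProd_succ]
      exact h.trans (le_mul_of_one_le_right h0.le (le_add_of_nonneg_right (by positivity)))
    · rw [truncMZV_append_singleton_succ, halfProd_succ]
      have h1 := ih (k ++ [a])
      rw [List.length_append, List.length_singleton, pow_succ] at h1 ⊢
      have h3 : ((M + 1 : ℝ) ^ (a : ℕ))⁻¹ ≤ (M + 1 : ℝ)⁻¹ := by
        gcongr
        exact le_self_pow₀ (by linarith [(Nat.cast_nonneg M : (0 : ℝ) ≤ M)]) a.pos.ne'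
      have h4 := mul_le_mul h3 (ih k) (truncMZV_nonneg _ _) (by positivity)
      refine (add_le_add h1 h4).trans (le_of_eq ?_)
      have : (M + 1 : ℝ) ≠ 0 := by positivity
      field_simp

/-- The new term at M + 1 is at most a constant times `halfProd M` / (M + 1)², which is dominated by
a difference of successive values of 2 `halfProd M` / M. The constant 4 makes the bracket equal to 1
for the first sum, since `halfProd 1` = 3/2. -/
theorem truncMZV_append_le {k : List ℕ+} {a : ℕ+} (ha : 2 ≤ a) (M : ℕ) :
    truncMZV (k ++ [a]) (M + 1) ≤
      2 ^ k.length * (4 - 2 * halfProd (M + 1) * (M + 1 : ℝ)⁻¹) := by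
  induction M with
  | zero =>
    rw [truncMZV_append_singleton_succ, truncMZV_zero (by simp)]
    have h1 := truncMZV_le_halfProd k 0
    simp only [halfProd, Finset.prod_range_zero, mul_one, zero_add, Finset.prod_range_one,
      Nat.cast_zero, one_pow, inv_one, one_mul] at h1 ⊢
    norm_num
    exact h1
  | succ M ih =>
    rw [truncMZV_append_singleton_succ, halfProd_succ]
    have h1 := mul_le_mul (inv_pow_le_inv_sq ha (M + 1)) (truncMZV_le_halfProd k (M + 1))
      (truncMZV_nonneg _ _) (by positivity)
    refine (add_le_add ih h1).trans ?_
    have h0 := halfProd_pos (M + 1)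
    have h2 : (((M + 1 : ℕ) + 1 : ℝ) ^ 2)⁻¹ ≤ 2 * (M + 1 : ℝ)⁻¹ -
        2 * (1 + (2 * (((M + 1 : ℕ) : ℝ) + 1))⁻¹) * (((M + 1 : ℕ) : ℝ) + 1)⁻¹ := by
      have hM : (0 : ℝ) ≤ M := Nat.cast_nonneg M
      push_cast
      rw [← sub_nonneg]
      have : 2 * (M + 1 : ℝ)⁻¹ - 2 * (1 + (2 * ((M + 1 : ℝ) + 1))⁻¹) * ((M + 1 : ℝ) + 1)⁻¹ -
          (((M : ℝ) + 1 + 1) ^ 2)⁻¹ = 2 * ((M + 1 : ℝ) * ((M : ℝ) + 2) ^ 2)⁻¹ := by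
        field_simp
        ring
      rw [this]
      positivity
    have h3 := mul_le_mul_of_nonneg_left h2
      (show (0 : ℝ) ≤ 2 ^ k.length * halfProd (M + 1) by positivity)
    push_cast at h3 ⊢
    linarith

theorem regMZV_admissible {k : List ℕ+} (hk : Admissible k) : regMZV k = mzv k := by
  rw [regMZV, isStuffleRegularization_stuffleReg.admissible k hk, Polynomial.eval_C]

theorem abs_regMZV_le_of_admissible {k : List ℕ+} (hk : Admissible k) :
    |regMZV k| ≤ 2 ^ (k.length + 1) := by
  have hlim := (hasLogExpansion_admissible hk).1
  rw [regMZV_admissible hk, abs_of_nonneg (ge_of_tendsto' hlim fun M => truncMZV_nonneg k M)]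
  by_cases hnil : k = []
  · subst hnil
    refine le_of_tendsto' hlim fun M => ?_
    norm_num
  obtain ⟨k, a, ha, rfl⟩ := hk.exists_eq hnil
  refine le_of_tendsto' (hlim.comp (tendsto_add_atTop_nat 1)) fun M => ?_
  refine (truncMZV_append_le ha M).trans ?_
  have := halfProd_pos (M + 1)
  have h2 : (0 : ℝ) ≤ 2 * halfProd (M + 1) * (M + 1 : ℝ)⁻¹ := by positivity
  have h3 : (2 : ℝ) ^ k.length * (4 - 2 * halfProd (M + 1) * (M + 1 : ℝ)⁻¹) ≤ 2 ^ k.length * 4 :=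
    mul_le_mul_of_nonneg_left (by linarith) (by positivity)
  refine h3.trans (le_of_eq ?_)
  rw [List.length_append, List.length_singleton]
  ring

/-- At T = 0 the product with z₁ vanishes, so (c + 1) ζ^∗(w z₁) is minus the sum over the remainder:
at most 2d words of length at most d = |w| + 1 with at most c trailing ones. The binomial
coefficient satisfies the resulting recursion. -/
theorem abs_regMZV_le_choose (c : ℕ) :
    |regMZV (List.replicate c 1)| ≤ 2 ^ (c + 1) * (2 * c + c).choose c ∧
      ∀ w, TrailingOnesLE c w →
        |regMZV w| ≤ 2 ^ (w.length + 1) * (2 * w.length + c).choose c := by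
  have key := append_singleton_induction
    (P := fun c w => |regMZV w| ≤ 2 ^ (w.length + 1) * (2 * w.length + c).choose c) ?_ ?_ ?_ c
  · simpa using key
  · intro c w h
    refine h.trans ?_
    gcongr ?_ * ?_
    have h1 := Nat.add_one_mul_choose_eq (2 * w.length + c) c
    have h2 : (2 * w.length + c).choose c * (c + 1) ≤
        (2 * w.length + c + 1).choose (c + 1) * (c + 1) := by
      rw [← h1, mul_comm]
      gcongr
      omega
    exact_mod_cast Nat.le_of_mul_le_mul_right h2 c.succ_pos
  · intro w hw
    simpa using abs_regMZV_le_of_admissible hw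
  · intro w c L hL hp _ h
    have h1 := isStuffleRegularization_stuffleReg.mul [1] w
    rw [natCast_mul_append_one stuffleReg hp, isStuffleRegularization_stuffleReg.one] at h1
    have h2 := congrArg (Polynomial.eval 0) h1
    have h3 : Polynomial.eval 0 (L.map stuffleReg).sum = (L.map regMZV).sum := by
      rw [← Polynomial.coe_evalRingHom, map_list_sum, List.map_map]
      rfl
    rw [Polynomial.eval_mul, Polynomial.eval_X, zero_mul, Polynomial.eval_add, Polynomial.eval_mul,
      Polynomial.eval_natCast, h3] at h2
    change 0 = _ * regMZV (w ++ [1]) + _ at h2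
    set d := w.length + 1 with hd
    have h4 : |(L.map regMZV).sum| ≤ 2 * d * (2 ^ (d + 1) * (2 * d + c).choose c) := by
      have : ∀ L' : List (List ℕ+), (∀ l ∈ L', l ∈ L) → |(L'.map regMZV).sum| ≤
          L'.length * (2 ^ (d + 1) * (2 * d + c).choose c) := by
        intro L' hL'
        induction L' with
        | nil => simp
        | cons l L' ih =>
          have hl := h l (hL' l (by simp))
          have hlen := hL.length_word_le l (hL' l (by simp))
          have ih := ih fun l' hl' => hL' l' (by simp [hl'])
          have : |regMZV l| ≤ 2 ^ (d + 1) * (2 * d + c).choose c := by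
            refine hl.trans ?_
            have hc : (2 * l.length + c).choose c ≤ (2 * d + c).choose c :=
              Nat.choose_le_choose c (by omega)
            have hc' : ((2 * l.length + c).choose c : ℝ) ≤ (2 * d + c).choose c := by exact_mod_cast hc
            have h2 : (2 : ℝ) ^ (l.length + 1) ≤ 2 ^ (d + 1) :=
              pow_le_pow_right₀ one_le_two (by omega)
            gcongr
          rw [List.map_cons, List.sum_cons, List.length_cons]
          refine (abs_add_le _ _).trans ?_
          push_cast
          linarith
      refine (this L fun l hl => hl).trans ?_
      gcongr
      have := hL.length_le
      have : L.length ≤ 2 * d := by omega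
      exact_mod_cast this
    have h5 : ((c + 1 : ℕ) : ℝ) * |regMZV (w ++ [1])| = |(L.map regMZV).sum| := by
      rw [← abs_of_nonneg (show (0 : ℝ) ≤ ((c + 1 : ℕ) : ℝ) by positivity), ← abs_mul,
        show ((c + 1 : ℕ) : ℝ) * regMZV (w ++ [1]) = -(L.map regMZV).sum by linarith, abs_neg]
    have h6 := Nat.add_one_mul_choose_eq (2 * d + c) c
    have h7 : ((2 * d + c + 1 : ℕ) : ℝ) * ((2 * d + c).choose c : ℝ) =
        ((2 * d + (c + 1)).choose (c + 1) : ℝ) * ((c + 1 : ℕ) : ℝ) := by exact_mod_cast h6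
    have hlen : (w ++ [1]).length = d := by simp [hd]
    rw [hlen]
    have hc : (0 : ℝ) < ((c + 1 : ℕ) : ℝ) := by positivity
    refine le_of_mul_le_mul_left ?_ hc
    rw [h5]
    refine h4.trans ?_
    -- The factor 2d is enlarged to 2d + c + 1 so that the absorption identity turns the binomial
    -- coefficient at c into the one at c + 1.
    have h8 : (2 * d : ℝ) * ((2 * d + c).choose c : ℝ) ≤
        ((2 * d + c + 1 : ℕ) : ℝ) * ((2 * d + c).choose c : ℝ) := by
      gcongr
      exact_mod_cast (by omega : 2 * d ≤ 2 * d + c + 1)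
    rw [h7] at h8
    have h9 := mul_le_mul_of_nonneg_left h8 (show (0 : ℝ) ≤ 2 ^ (d + 1) by positivity)
    linarith

theorem abs_regMZV_le (w : List ℕ+) : |regMZV w| ≤ 2 * 16 ^ w.length := by
  have key : ∀ c, c ≤ w.length → |regMZV w| ≤ 2 ^ (w.length + 1) * (2 * w.length + c).choose c →
      |regMZV w| ≤ 2 * 16 ^ w.length := by
    intro c hc h
    refine h.trans ?_
    have h1 : (2 * w.length + c).choose c ≤ 2 ^ (3 * w.length) :=
      (Nat.choose_le_two_pow _ _).trans (Nat.pow_le_pow_right two_pos (by omega))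
    have h2 : ((2 * w.length + c).choose c : ℝ) ≤ 2 ^ (3 * w.length) := by exact_mod_cast h1
    calc (2 : ℝ) ^ (w.length + 1) * (2 * w.length + c).choose c
        ≤ 2 ^ (w.length + 1) * 2 ^ (3 * w.length) := by gcongr
      _ = 2 * 16 ^ w.length := by
        rw [show (16 : ℝ) = 2 ^ 4 by norm_num, ← pow_mul, ← pow_add, ← pow_succ']
        congr 1
        ring
  rcases trailingOnesLE_or w with ⟨c, rfl⟩ | ⟨c, v, a, j, ha, hj, rfl⟩
  · exact key c (by simp) (by simpa using (abs_regMZV_le_choose c).1)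
  · exact key j (by simp; omega) ((abs_regMZV_le_choose j).2 _ ⟨v, a, j, ha, le_rfl, rfl⟩)

theorem exists_FConvergesAt (α β γ : ℕ+) : ∃ r : ℝ, 0 < r ∧ FConvergesAt α β γ r r := by
  -- The word has length a + c + 1, so its value is at most 32 · 16^{a+c}; radius 1/32 leaves
  -- geometric series of ratio 1/2.
  refine ⟨1 / 32, by norm_num, ?_⟩
  have hg : Summable fun n : ℕ => (1 / 2 : ℝ) ^ n := summable_geometric_two
  have h := (hg.mul_of_nonneg hg (fun n => by positivity) (fun n => by positivity)).mul_left 32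
  refine Summable.of_nonneg_of_le (fun p => by positivity) (fun p => ?_) h
  have h1 := abs_regMZV_le (List.replicate p.1 α ++ β :: List.replicate p.2 γ)
  simp only [List.length_append, List.length_replicate, List.length_cons] at h1
  change |zetaStar α β γ p.1 p.2| ≤ _ at h1
  calc |zetaStar α β γ p.1 p.2| * (1 / 32) ^ p.1 * (1 / 32) ^ p.2
      ≤ 2 * 16 ^ (p.1 + (p.2 + 1)) * (1 / 32) ^ p.1 * (1 / 32) ^ p.2 := by gcongr
    _ = 32 * ((1 / 2) ^ p.1 * (1 / 2) ^ p.2) := by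
      rw [show (1 / 32 : ℝ) = 1 / 16 * (1 / 2) by norm_num, mul_pow, mul_pow, pow_add, pow_succ]
      simp only [one_div, inv_pow]
      field_simp
      norm_num

end SchurMZV

namespace SchurMZV

/-! ### A Jacobi–Trudi formula for weights depending on the content -/

section JacobiTrudi

variable {K : Type*} [CommRing K] {b N : ℕ}

/-- The tableaux with column lengths `l` and entries in `{1, …, M}`, given by columns. -/
structure IsColumnTableau (M : ℕ) (l : Fin b → ℤ) (t : Fin b → Fin N → ℕ) : Prop where
  ne_zero_iff : ∀ j (i : Fin N), t j i ≠ 0 ↔ (i : ℤ) < l j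
  le : ∀ j i, t j i ≤ M
  col_strict : ∀ j (i i' : Fin N), i < i' → (i' : ℤ) < l j → t j i < t j i'
  row_weak : ∀ j j' (i : Fin N), j < j' → (i : ℤ) < l j' → t j i ≤ t j' i

open scoped Classical in
/-- The finite set of tableaux with column lengths `l` and entries in `{1, …, M}`. -/
noncomputable def columnTableaux (N M : ℕ) (l : Fin b → ℤ) : Finset (Fin b → Fin N → ℕ) :=
  (Finset.Icc 0 (fun _ _ => M)).filter (IsColumnTableau M l)

theorem mem_columnTableaux {M : ℕ} {l : Fin b → ℤ} {t : Fin b → Fin N → ℕ} :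
    t ∈ columnTableaux N M l ↔ IsColumnTableau M l t := by
  classical
  simp only [columnTableaux, Finset.mem_filter, Finset.mem_Icc, and_iff_right_iff_imp]
  exact fun h => ⟨fun j i => Nat.zero_le _, h.le⟩

/-- The weight of a tableau: an entry `M + 1` in a cell of content `c` contributes `y M c`. -/
def tableauWeight (y : ℕ → ℤ → K) (l : Fin b → ℤ) (t : Fin b → Fin N → ℕ) : K :=
  ∏ j, ∏ i : Fin N, if (i : ℤ) < l j then y (t j i - 1) ((j : ℤ) - i) else 1

/-- The generating function of the tableaux with column lengths `l`. -/
noncomputable def tableauSum (N : ℕ) (y : ℕ → ℤ → K) (M : ℕ) (l : Fin b → ℤ) : K :=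
  ∑ t ∈ columnTableaux N M l, tableauWeight y l t

/-- The column lengths `l` with the bottom cells of the columns in `S` removed. -/
def removeBottom (l : Fin b → ℤ) (S : Finset (Fin b)) (j : Fin b) : ℤ :=
  l j - if j ∈ S then 1 else 0

/-- The columns of `t` that contain the entry `M + 1`. -/
def columnsWith (M : ℕ) (t : Fin b → Fin N → ℕ) : Finset (Fin b) :=
  Finset.univ.filter fun j => ∃ i, t j i = M + 1

theorem mem_columnsWith {M : ℕ} {t : Fin b → Fin N → ℕ} {j : Fin b} :
    j ∈ columnsWith M t ↔ ∃ i, t j i = M + 1 := by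
  simp [columnsWith]

/-! ### Removing and restoring the largest entry of a tableau. -/

theorem IsColumnTableau.eq_of_max {M : ℕ} {l : Fin b → ℤ} {t : Fin b → Fin N → ℕ}
    (hN : ∀ j, l j ≤ N) (h : IsColumnTableau (M + 1) l t) {j : Fin b} {i : Fin N}
    (hi : t j i = M + 1) : (i : ℤ) = l j - 1 := by
  have h1 : (i : ℤ) < l j := (h.ne_zero_iff j i).1 (by omega)
  by_contra hne
  have h2 := hN j
  have h3 := h.col_strict j i ⟨i + 1, by omega⟩ (Fin.mk_lt_mk.2 (Nat.lt_succ_self _))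
    (by push_cast; omega)
  have h4 := h.le j ⟨i + 1, by omega⟩
  omega

theorem IsColumnTableau.max_iff {M : ℕ} {l : Fin b → ℤ} {t : Fin b → Fin N → ℕ}
    (hN : ∀ j, l j ≤ N) (h : IsColumnTableau (M + 1) l t) {j : Fin b} {i : Fin N} :
    t j i = M + 1 ↔ j ∈ columnsWith M t ∧ (i : ℤ) = l j - 1 := by
  refine ⟨fun hi => ⟨mem_columnsWith.2 ⟨i, hi⟩, h.eq_of_max hN hi⟩, ?_⟩
  rintro ⟨hj, hi⟩
  obtain ⟨i', hi'⟩ := mem_columnsWith.1 hj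
  have := h.eq_of_max hN hi'
  obtain rfl : i = i' := Fin.ext (by omega)
  exact hi'

/-- The order could fail only if, of two columns of equal length, the left one lost its bottom cell
and the right one did not. But M + 1 at the bottom of the left column forces M + 1 to its right in
the same row. -/
theorem IsColumnTableau.antitone_removeBottom {M : ℕ} {l : Fin b → ℤ} {t : Fin b → Fin N → ℕ}
    (hl : Antitone l) (hN : ∀ j, l j ≤ N) (h : IsColumnTableau (M + 1) l t) :
    Antitone (removeBottom l (columnsWith M t)) := by
  intro j j' hjj'
  rcases hjj'.eq_or_lt with rfl | hlt
  · exact le_rfl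
  have h1 := hl hjj'
  unfold removeBottom
  by_cases hj : j ∈ columnsWith M t
  · by_cases hj' : j' ∈ columnsWith M t
    · rw [if_pos hj, if_pos hj']; omega
    · rw [if_pos hj, if_neg hj']
      by_contra hcon
      obtain ⟨i, hi⟩ := mem_columnsWith.1 hj
      have h2 := h.eq_of_max hN hi
      have h3 := h.row_weak j j' i hlt (by omega)
      have h4 := h.le j' i
      exact hj' (mem_columnsWith.2 ⟨i, by omega⟩)
  · rw [if_neg hj]
    split_ifs <;> omega

theorem IsColumnTableau.removeBottom_nonneg {M : ℕ} {l : Fin b → ℤ} {t : Fin b → Fin N → ℕ}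
    (h0 : ∀ j, 0 ≤ l j) (hN : ∀ j, l j ≤ N) (h : IsColumnTableau (M + 1) l t) (j : Fin b) :
    0 ≤ removeBottom l (columnsWith M t) j := by
  unfold removeBottom
  split_ifs with hj
  · obtain ⟨i, hi⟩ := mem_columnsWith.1 hj
    have := h.eq_of_max hN hi
    omega
  · have := h0 j
    omega

theorem IsColumnTableau.reduce {M : ℕ} {l : Fin b → ℤ} {t : Fin b → Fin N → ℕ}
    (hl : Antitone l) (hN : ∀ j, l j ≤ N) (h : IsColumnTableau (M + 1) l t) :
    IsColumnTableau M (removeBottom l (columnsWith M t))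
      (fun j i => if t j i = M + 1 then 0 else t j i) := by
  have key : ∀ j (i : Fin N), (i : ℤ) < removeBottom l (columnsWith M t) j ↔
      (i : ℤ) < l j ∧ t j i ≠ M + 1 := by
    intro j i
    rw [Ne, h.max_iff hN]
    unfold removeBottom
    split_ifs with hj
    · simp only [hj, true_and]; omega
    · simp [hj]
  have hanti := h.antitone_removeBottom hl hN
  constructor
  · intro j i
    rw [key, ← h.ne_zero_iff]
    split_ifs with h1 <;> simp [h1]
  · intro j i
    have := h.le j i
    split_ifs <;> omega
  · intro j i i' hi hi'
    have h1 := (key j i).1 (by have : (i : ℕ) < i' := hi; omega)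
    have h2 := (key j i').1 hi'
    rw [if_neg h1.2, if_neg h2.2]
    exact h.col_strict j i i' hi h2.1
  · intro j j' i hj hi
    have h1 := (key j i).1 (hi.trans_le (hanti hj.le))
    have h2 := (key j' i).1 hi
    rw [if_neg h1.2, if_neg h2.2]
    exact h.row_weak j j' i hj h2.1

theorem IsColumnTableau.extend {M : ℕ} {l : Fin b → ℤ} {t : Fin b → Fin N → ℕ}
    {S : Finset (Fin b)} (hanti : Antitone (removeBottom l S))
    (h : IsColumnTableau M (removeBottom l S) t) :
    IsColumnTableau (M + 1) l (fun j (i : Fin N) => if j ∈ S ∧ (i : ℤ) = l j - 1 then M + 1 else t j i) := by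
  have key : ∀ j (i : Fin N), (i : ℤ) < removeBottom l S j ↔
      (i : ℤ) < l j ∧ ¬ (j ∈ S ∧ (i : ℤ) = l j - 1) := by
    intro j i
    unfold removeBottom
    split_ifs with hj
    · simp only [hj, true_and]; omega
    · simp [hj]
  constructor
  · intro j i
    split_ifs with h1
    · simp only [ne_eq, Nat.add_eq_zero_iff, one_ne_zero, and_false, not_false_eq_true, true_iff]
      omega
    · rw [h.ne_zero_iff, key]
      simp [h1]
  · intro j i
    have := h.le j i
    split_ifs <;> omega
  · intro j i i' hi hi'
    have hi2 : (i : ℕ) < i' := hi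
    rw [if_neg (by omega)]
    split_ifs with h1
    · have := h.le j i
      omega
    · exact h.col_strict j i i' hi ((key j i').2 ⟨hi', h1⟩)
  · intro j j' i hj hi
    have h3 := h.le j i
    by_cases h1 : j' ∈ S ∧ (i : ℤ) = l j' - 1
    · rw [if_pos h1]
      split_ifs <;> omega
    · have h2 := (key j' i).2 ⟨hi, h1⟩
      have h4 := ((key j i).1 (h2.trans_le (hanti hj.le))).2
      rw [if_neg h1, if_neg h4]
      exact h.row_weak j j' i hj h2

theorem columnsWith_extend {M : ℕ} {l : Fin b → ℤ} {t : Fin b → Fin N → ℕ}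
    {S : Finset (Fin b)} (hN : ∀ j, l j ≤ N) (hnonneg : ∀ j, 0 ≤ removeBottom l S j)
    (h : IsColumnTableau M (removeBottom l S) t) :
    columnsWith M (fun j (i : Fin N) => if j ∈ S ∧ (i : ℤ) = l j - 1 then M + 1 else t j i) = S := by
  ext j
  rw [mem_columnsWith]
  constructor
  · rintro ⟨i, hi⟩
    by_contra hj
    have := h.le j i
    rw [if_neg (by tauto)] at hi
    omega
  · intro hj
    have h1 := hnonneg j
    have h2 := hN j
    rw [removeBottom, if_pos hj] at h1
    refine ⟨⟨(l j - 1).toNat, by omega⟩, ?_⟩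
    rw [if_pos ⟨hj, by simp; omega⟩]

theorem IsColumnTableau.weight_eq {y : ℕ → ℤ → K} {M : ℕ} {l : Fin b → ℤ}
    {t : Fin b → Fin N → ℕ} (hN : ∀ j, l j ≤ N) (h : IsColumnTableau (M + 1) l t) :
    tableauWeight y l t = (∏ j ∈ columnsWith M t, y M ((j : ℤ) - l j + 1)) *
      tableauWeight y (removeBottom l (columnsWith M t))
        (fun j i => if t j i = M + 1 then 0 else t j i) := by
  classical
  unfold tableauWeight
  rw [← Fintype.prod_ite_mem (columnsWith M t), ← Finset.prod_mul_distrib]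
  refine Finset.prod_congr rfl fun j _ => ?_
  split_ifs with hj
  · obtain ⟨i₀, hi₀⟩ := mem_columnsWith.1 hj
    have h1 := h.eq_of_max hN hi₀
    rw [← Fintype.prod_ite_eq i₀ (fun _ => y M ((j : ℤ) - l j + 1)), ← Finset.prod_mul_distrib]
    refine Finset.prod_congr rfl fun i _ => ?_
    simp only [removeBottom, if_pos hj]
    by_cases hi : i₀ = i
    · subst hi
      rw [if_pos rfl, if_pos (by omega), if_neg (by omega), hi₀, mul_one, Nat.add_sub_cancel]
      congr 1
      omega
    · have hne : t j i ≠ M + 1 := fun hc => hi (Fin.ext (by have := h.eq_of_max hN hc; omega))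
      have hne' : (i : ℤ) ≠ l j - 1 := fun hc => hi (Fin.ext (by omega))
      rw [if_neg hi, one_mul, if_neg hne]
      exact if_congr (by omega) rfl rfl
  · rw [one_mul]
    refine Finset.prod_congr rfl fun i _ => ?_
    have hne : t j i ≠ M + 1 := fun hc => hj (mem_columnsWith.2 ⟨i, hc⟩)
    simp [removeBottom, hj, hne]

-- Tableaux are sorted by the set S of columns containing M + 1. By strictness this entry sits only
-- in the bottom cell, of content j - l j + 1, and deleting these cells is a bijection onto tableaux
-- with entries at most M, provided the new lengths are again a shape.
open scoped Classical in
theorem tableauSum_succ (y : ℕ → ℤ → K) (M : ℕ) {l : Fin b → ℤ} (hl : Antitone l)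
    (h0 : ∀ j, 0 ≤ l j) (hN : ∀ j, l j ≤ N) :
    tableauSum N y (M + 1) l = ∑ S : Finset (Fin b),
      (∏ j ∈ S, y M ((j : ℤ) - l j + 1)) *
        if Antitone (removeBottom l S) ∧ ∀ j, 0 ≤ removeBottom l S j then
          tableauSum N y M (removeBottom l S) else 0 := by
  classical
  unfold tableauSum
  rw [← Finset.sum_fiberwise (s := columnTableaux N (M + 1) l) (g := columnsWith M)]
  refine Finset.sum_congr rfl fun S _ => ?_
  split_ifs with hS
  · rw [Finset.mul_sum]
    refine Finset.sum_bij' (fun t _ j i => if t j i = M + 1 then 0 else t j i)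
      (fun t _ j (i : Fin N) => if j ∈ S ∧ (i : ℤ) = l j - 1 then M + 1 else t j i) ?_ ?_ ?_ ?_ ?_
    · intro t ht'
      obtain ⟨ht, rfl⟩ := Finset.mem_filter.1 ht'
      exact mem_columnTableaux.2 ((mem_columnTableaux.1 ht).reduce hl hN)
    · intro t ht
      have ht := mem_columnTableaux.1 ht
      exact Finset.mem_filter.2 ⟨mem_columnTableaux.2 (ht.extend hS.1),
        columnsWith_extend hN hS.2 ht⟩
    · intro t ht'
      obtain ⟨ht, rfl⟩ := Finset.mem_filter.1 ht'
      have ht := mem_columnTableaux.1 ht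
      funext j i
      dsimp only
      by_cases h : t j i = M + 1
      · rw [if_pos ((ht.max_iff hN).1 h), h]
      · rw [if_neg (mt (ht.max_iff hN).2 h), if_neg h]
    · intro t ht
      have ht := mem_columnTableaux.1 ht
      funext j i
      have h1 := ht.le j i
      dsimp only
      by_cases h : j ∈ S ∧ (i : ℤ) = l j - 1
      · simp only [if_pos h, if_true]
        by_contra hne
        have := (ht.ne_zero_iff j i).1 (Ne.symm hne)
        rw [removeBottom, if_pos h.1] at this
        omega
      · simp only [if_neg h]
        exact if_neg (by omega)
    · intro t ht'
      obtain ⟨ht, rfl⟩ := Finset.mem_filter.1 ht'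
      have h1 : IsColumnTableau (M + 1) l t := mem_columnTableaux.1 ht
      exact h1.weight_eq hN
  · rw [mul_zero]
    refine Finset.sum_eq_zero fun t ht => ?_
    rw [Finset.mem_filter] at ht
    obtain ⟨ht, rfl⟩ := ht
    replace ht := mem_columnTableaux.1 ht
    exact absurd ⟨ht.antitone_removeBottom hl hN, ht.removeBottom_nonneg h0 hN⟩ hS

theorem tableauSum_zero (y : ℕ → ℤ → K) {l : Fin b → ℤ}
    (h0 : ∀ j, 0 ≤ l j) (hN : ∀ j, l j ≤ N) :
    tableauSum N y 0 l = if l = 0 then 1 else 0 := by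
  classical
  split_ifs with hl
  · subst hl
    have : columnTableaux N 0 (0 : Fin b → ℤ) = {0} := by
      ext t
      rw [mem_columnTableaux, Finset.mem_singleton]
      constructor
      · intro h
        funext j i
        exact Nat.le_zero.1 (h.le j i)
      · rintro rfl
        exact ⟨fun j i => by simp, fun j i => le_rfl, fun j i i' _ h => absurd h (by simp),
          fun j j' i _ _ => le_rfl⟩
    rw [tableauSum, this, Finset.sum_singleton, tableauWeight]
    refine Finset.prod_eq_one fun j _ => Finset.prod_eq_one fun i _ => if_neg ?_
    simp
  · refine Finset.sum_eq_zero fun t ht => absurd ?_ hl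
    have ht := mem_columnTableaux.1 ht
    funext j
    by_contra hne
    have h1 := h0 j
    have h2 := hN j
    have hne : l j ≠ 0 := hne
    have h3 := (ht.ne_zero_iff j ⟨0, by omega⟩).2 (by simp; omega)
    have h4 := ht.le j ⟨0, by omega⟩
    omega

/-! ### The same recursion for the Jacobi–Trudi determinant. -/

/-- The Jacobi–Trudi matrix for the column lengths `l`. -/
def jacobiTrudiMatrix (G : ℤ → ℤ → K) (l : Fin b → ℤ) : Matrix (Fin b) (Fin b) K :=
  Matrix.of fun i j => G j (l i + j - i)

/-- In entry (i, j) the weight has content j - (l i + j - i) + 1 = i - l i + 1, independent of j. So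
each new row is the old row plus a scalar times the row with l i lowered by 1, and multilinearity
expands over the rows S where the latter is chosen. -/
theorem det_jacobiTrudiMatrix_succ {y : ℕ → ℤ → K} {G : ℕ → ℤ → ℤ → K}
    (hs : ∀ M j k, G (M + 1) j k = G M j k + y M (j - k + 1) * G M j (k - 1)) (M : ℕ)
    (l : Fin b → ℤ) :
    (jacobiTrudiMatrix (G (M + 1)) l).det = ∑ S : Finset (Fin b),
      (∏ j ∈ S, y M ((j : ℤ) - l j + 1)) * (jacobiTrudiMatrix (G M) (removeBottom l S)).det := by
  classical
  let m : Fin b → Fin b → K := fun i j => G M j (l i - 1 + j - i)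
  let m' : Fin b → Fin b → K := fun i j => G M j (l i + j - i)
  let c : Fin b → K := fun i => y M ((i : ℤ) - l i + 1)
  have h1 : jacobiTrudiMatrix (G (M + 1)) l = (fun i => c i • m i) + m' := by
    ext i j
    simp only [jacobiTrudiMatrix, Matrix.of_apply, hs, Pi.add_apply, Pi.smul_apply, smul_eq_mul,
      c, m, m']
    rw [add_comm]
    congr 3 <;> ring
  have h2 : (jacobiTrudiMatrix (G (M + 1)) l).det =
      Matrix.detRowAlternating.toMultilinearMap ((fun i => c i • m i) + m') := by rw [h1]; rfl
  rw [h2, MultilinearMap.map_add_univ]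
  refine Finset.sum_congr rfl fun S _ => ?_
  let r : Fin b → Fin b → K := S.piecewise m m'
  have h3 : S.piecewise (fun i => c i • m i) m' = S.piecewise (fun i => c i • r i) r := by
    funext i
    by_cases hi : i ∈ S
    · simp only [r, Finset.piecewise_eq_of_mem _ _ _ hi]
    · simp only [r, Finset.piecewise_eq_of_notMem _ _ _ hi]
  have h4 : jacobiTrudiMatrix (G M) (removeBottom l S) = r := by
    ext i j
    by_cases hi : i ∈ S
    · simp [jacobiTrudiMatrix, removeBottom, hi, r, m]
    · simp [jacobiTrudiMatrix, removeBottom, hi, r, m']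
  rw [h3, MultilinearMap.map_piecewise_smul, smul_eq_mul, h4]
  rfl

/-- If monotonicity fails, it fails by exactly one at consecutive rows, which then coincide. If it
holds but a length is negative, the last length is negative and the last row is zero. -/
theorem det_jacobiTrudiMatrix_removeBottom {G : ℤ → ℤ → K} (hneg : ∀ j k, k < 0 → G j k = 0)
    {l : Fin b → ℤ} (hl : Antitone l) {S : Finset (Fin b)}
    (hS : ¬ (Antitone (removeBottom l S) ∧ ∀ j, 0 ≤ removeBottom l S j)) :
    (jacobiTrudiMatrix G (removeBottom l S)).det = 0 := by
  rcases b with _ | n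
  · exact absurd ⟨fun j => j.elim0, fun j => j.elim0⟩ hS
  by_cases ha : Antitone (removeBottom l S)
  · simp only [ha, true_and, not_forall, not_le] at hS
    obtain ⟨j, hj⟩ := hS
    refine Matrix.det_eq_zero_of_row_eq_zero (Fin.last n) fun j' => hneg _ _ ?_
    have h1 := ha (Fin.le_last j)
    have h2 : (j' : ℕ) ≤ n := Nat.lt_succ_iff.1 j'.2
    simp only [Fin.val_last]
    omega
  · rw [Fin.antitone_iff_succ_le] at ha
    push Not at ha
    obtain ⟨i, hi⟩ := ha
    have h1 : l i.succ ≤ l i.castSucc := hl (Fin.castSucc_lt_succ (i := i)).le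
    have h2 : removeBottom l S i.castSucc + 1 = removeBottom l S i.succ := by
      unfold removeBottom at hi ⊢
      split_ifs at hi ⊢ <;> omega
    refine Matrix.det_zero_of_row_eq (Fin.castSucc_lt_succ (i := i)).ne ?_
    funext j
    simp only [jacobiTrudiMatrix, Matrix.of_apply, ← h2, Fin.val_castSucc, Fin.val_succ]
    congr 1
    push_cast
    ring

theorem tableauSum_eq_det {y : ℕ → ℤ → K} {G : ℕ → ℤ → ℤ → K}
    (hs : ∀ M j k, G (M + 1) j k = G M j k + y M (j - k + 1) * G M j (k - 1))
    (hneg : ∀ M j k, k < 0 → G M j k = 0) (hz : ∀ j k, G 0 j k = if k = 0 then 1 else 0)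
    (M : ℕ) {l : Fin b → ℤ} (hl : Antitone l) (h0 : ∀ j, 0 ≤ l j) (hN : ∀ j, l j ≤ N) :
    tableauSum N y M l = (jacobiTrudiMatrix (G M) l).det := by
  classical
  induction M generalizing l with
  | zero =>
    rw [tableauSum_zero y h0 hN]
    split_ifs with h
    · subst h
      have : jacobiTrudiMatrix (G 0) (0 : Fin b → ℤ) = 1 := by
        ext i j
        simp only [jacobiTrudiMatrix, Matrix.of_apply, hz, Matrix.one_apply, Pi.zero_apply]
        refine if_congr ?_ rfl rfl
        rw [Fin.ext_iff]
        omega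
      rw [this, Matrix.det_one]
    · obtain ⟨j, hj⟩ := Function.ne_iff.1 h
      have hb : 0 < b := j.pos
      symm
      refine Matrix.det_eq_zero_of_row_eq_zero ⟨0, hb⟩ fun j' => ?_
      simp only [jacobiTrudiMatrix, Matrix.of_apply, hz]
      refine if_neg ?_
      -- A nonzero l has l 0 > 0, so every entry of the first row has positive second argument and
      -- vanishes at M = 0.
      have h1 := hl (show (⟨0, hb⟩ : Fin b) ≤ j from Nat.zero_le _)
      have h2 := h0 j
      have h3 : l j ≠ 0 := hj
      simp only [Nat.cast_zero]
      omega
  | succ M ih =>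
    rw [tableauSum_succ y M hl h0 hN, det_jacobiTrudiMatrix_succ hs]
    refine Finset.sum_congr rfl fun S _ => ?_
    congr 1
    split_ifs with hS
    · refine ih hS.1 hS.2 fun j => ?_
      have := hN j
      unfold removeBottom
      split_ifs <;> omega
    · exact (det_jacobiTrudiMatrix_removeBottom (hneg M) hl hS).symm

end JacobiTrudi

end SchurMZV

namespace SchurMZV

/-! ### Rectangular Schur multiple zeta values as determinants -/

/-- The list `a_s, a_{s-1}, …, a_{s-n+1}`. -/
def diagList (α β γ : ℕ+) (s : ℤ) (n : ℕ) : List ℕ+ :=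
  (List.range n).map fun i : ℕ => diagSeq α β γ (s - i)

theorem diagList_succ (α β γ : ℕ+) (s : ℤ) (n : ℕ) :
    diagList α β γ s (n + 1) = diagList α β γ s n ++ [diagSeq α β γ (s - n)] := by
  simp [diagList, List.range_succ]

theorem diagList_eq (α β γ : ℕ+) (u v : ℕ) :
    diagList α β γ u (u + 1 + v) = List.replicate u α ++ β :: List.replicate v γ := by
  have hlen : (diagList α β γ u (u + 1 + v)).length =
      (List.replicate u α ++ β :: List.replicate v γ).length := by
    simp [diagList]; omega
  refine List.ext_getElem hlen fun i h1 h2 => ?_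
  simp only [diagList, List.getElem_map, List.getElem_range, diagSeq]
  rcases lt_trichotomy i u with h | rfl | h
  · rw [List.getElem_append_left (by simpa using h), List.getElem_replicate,
      if_neg (by omega), if_neg (by omega)]
  · rw [List.getElem_append_right (by simp)]
    simp
  · rw [List.getElem_append_right (by simpa using h.le), if_pos (by omega)]
    obtain ⟨n, rfl⟩ := Nat.exists_eq_add_of_lt h
    simp [show u + n + 1 - u = n + 1 by omega]

/-- The truncated value of a segment of length `k` of the diagonal sequence shifted by `m`,
zero for negative `k`. -/
noncomputable def segmentMZV (α β γ : ℕ+) (m : ℤ) (M : ℕ) (j k : ℤ) : ℝ :=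
  if k < 0 then 0 else truncMZV (diagList α β γ (j + m) k.toNat) M

theorem segmentMZV_succ (α β γ : ℕ+) (m : ℤ) (M : ℕ) (j k : ℤ) :
    segmentMZV α β γ m (M + 1) j k = segmentMZV α β γ m M j k +
      ((M + 1 : ℝ) ^ (diagSeq α β γ (j - k + 1 + m) : ℕ))⁻¹ * segmentMZV α β γ m M j (k - 1) := by
  unfold segmentMZV
  rcases lt_trichotomy k 0 with h | rfl | h
  · rw [if_pos h, if_pos h, if_pos (by omega)]; simp
  · simp [diagList]
  · obtain ⟨n, rfl⟩ : ∃ n : ℕ, k = n + 1 := ⟨(k - 1).toNat, by omega⟩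
    rw [if_neg (by omega), if_neg (by omega), if_neg (by omega),
      show ((n : ℤ) + 1).toNat = n + 1 by omega, show ((n : ℤ) + 1 - 1).toNat = n by omega,
      diagList_succ, truncMZV_append_singleton_succ,
      show j - ((n : ℤ) + 1) + 1 + m = j + m - n by ring]

theorem segmentMZV_zero (α β γ : ℕ+) (m j k : ℤ) :
    segmentMZV α β γ m 0 j k = if k = 0 then 1 else 0 := by
  unfold segmentMZV
  rcases lt_trichotomy k 0 with h | rfl | h
  · rw [if_pos h, if_neg h.ne]
  · simp [diagList]
  · rw [if_neg (by omega), if_neg h.ne', truncMZV_zero]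
    simp [diagList]; omega

theorem mem_rect {p q i j : ℕ} : (i, j) ∈ rect p q ↔ i < p ∧ j < q := by
  rw [← YoungDiagram.mem_cells]
  simp [rect]

theorem truncSchurMZV_rect (p q : ℕ) (d : ℤ → ℕ+) (M : ℕ) :
    truncSchurMZV (rect p q) (fun ij => d ((ij.2 : ℤ) - (ij.1 : ℤ))) M =
      tableauSum p (fun M c => ((M + 1 : ℝ) ^ (d c : ℕ))⁻¹) M (fun _ : Fin q => (p : ℤ)) := by
  unfold truncSchurMZV tableauSum
  rw [← finsum_mem_coe_finset]
  refine finsum_mem_eq_of_bijOn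
    (fun (t : SemistandardYoungTableau (rect p q)) (j : Fin q) (i : Fin p) => t i j) ⟨?_, ?_, ?_⟩ ?_
  · intro t ht
    rw [Finset.mem_coe, mem_columnTableaux]
    have hmem : ∀ (i : Fin p) (j : Fin q), ((i : ℕ), (j : ℕ)) ∈ rect p q := fun i j =>
      mem_rect.2 ⟨i.2, j.2⟩
    refine ⟨fun j i => ?_, fun j i => (ht _ (YoungDiagram.mem_cells _ |>.2 (hmem i j))).2,
      fun j i i' hi _ => t.col_strict hi (hmem i' j),
      fun j j' i hj _ => t.row_weak hj (hmem i j')⟩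
    have := (ht _ (YoungDiagram.mem_cells _ |>.2 (hmem i j))).1
    have h2 := i.2
    change t i j ≠ 0 ↔ _
    simp only at this
    constructor
    · intro _; omega
    · intro _; omega
  · intro t _ t' _ h
    ext i j
    by_cases hc : (i, j) ∈ rect p q
    · have hij := mem_rect.1 hc
      exact congrFun (congrFun h ⟨j, hij.2⟩) ⟨i, hij.1⟩
    · rw [t.zeros hc, t'.zeros hc]
  · intro t ht
    rw [Finset.mem_coe, mem_columnTableaux] at ht
    let f : ℕ → ℕ → ℕ := fun i j => if h : i < p ∧ j < q then t ⟨j, h.2⟩ ⟨i, h.1⟩ else 0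
    have hf : ∀ {i j : ℕ} (h : i < p ∧ j < q), f i j = t ⟨j, h.2⟩ ⟨i, h.1⟩ := fun h => dif_pos h
    refine ⟨⟨f, ?_, ?_, ?_⟩, ?_, ?_⟩
    · intro i j j' hj hc
      have h := mem_rect.1 hc
      rw [hf ⟨h.1, hj.trans h.2⟩, hf h]
      exact ht.row_weak _ _ _ hj (by simpa using h.1)
    · intro i i' j hi hc
      have h := mem_rect.1 hc
      rw [hf ⟨hi.trans h.1, h.2⟩, hf h]
      exact ht.col_strict _ _ _ hi (by simpa using h.1)
    · intro i j hc
      rw [mem_rect] at hc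
      exact dif_neg hc
    · rintro ⟨i, j⟩ hc
      have h := mem_rect.1 ((YoungDiagram.mem_cells _).1 hc)
      have h1 := (ht.ne_zero_iff ⟨j, h.2⟩ ⟨i, h.1⟩).2 (by simpa using h.1)
      have h2 := ht.le ⟨j, h.2⟩ ⟨i, h.1⟩
      change 1 ≤ f i j ∧ f i j ≤ M
      rw [hf h]
      exact ⟨Nat.one_le_iff_ne_zero.2 h1, h2⟩
    · funext j i
      exact hf ⟨i.2, j.2⟩
  · intro t ht
    have hcells : (rect p q).cells = Finset.range p ×ˢ Finset.range q := rfl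
    rw [hcells, Finset.prod_product_right, tableauWeight, ← Fin.prod_univ_eq_prod_range
      (fun j => ∏ i ∈ Finset.range p, ((t i j : ℝ) ^ (d ((j : ℤ) - (i : ℤ)) : ℕ))⁻¹) q]
    refine Finset.prod_congr rfl fun j _ => ?_
    rw [← Fin.prod_univ_eq_prod_range
      (fun i => ((t i j : ℝ) ^ (d ((j : ℤ) - (i : ℤ)) : ℕ))⁻¹) p]
    refine Finset.prod_congr rfl fun i _ => ?_
    have h1 := (ht (i, j) ((YoungDiagram.mem_cells _).2 (mem_rect.2 ⟨i.2, j.2⟩))).1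
    simp only at h1
    rw [if_pos (by simp)]
    have : ((t i j - 1 : ℕ) : ℝ) + 1 = t i j := by
      rw [Nat.cast_sub h1]; simp
    rw [this]

/-- Entry (i, j) of the Jacobi–Trudi matrix is a segment of the diagonal sequence starting at a + j,
of length (a + n + 1 + c) + j - i: it contains a + j letters α, one β and c + n - i letters γ. The
identity holds for every M, hence for the regularized polynomials and at T = 0. -/
theorem R_eq_det (α β γ : ℕ+) (n a c : ℕ) :
    R α β γ (a : ℤ) (a + (n + 1) + c) (n + 1) =
      (Matrix.of fun i j : Fin (n + 1) => zetaStar α β γ (a + j) (c + (n - i))).det := by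
  have hexp : HasLogExpansion
      (truncSchurMZV (rect (a + (n + 1) + c) (n + 1))
        (fun ij => diagSeq α β γ ((ij.2 : ℤ) - (ij.1 : ℤ) + a)))
      (Matrix.of fun i j : Fin (n + 1) => stuffleReg
        (List.replicate (a + j) α ++ β :: List.replicate (c + (n - i)) γ)).det := by
    have h1 : ∀ M, truncSchurMZV (rect (a + (n + 1) + c) (n + 1))
        (fun ij => diagSeq α β γ ((ij.2 : ℤ) - (ij.1 : ℤ) + a)) M =
        (Matrix.of fun i j : Fin (n + 1) =>
          truncMZV (List.replicate (a + j) α ++ β :: List.replicate (c + (n - i)) γ) M).det := by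
      intro M
      rw [truncSchurMZV_rect _ _ (fun c => diagSeq α β γ (c + a)),
        tableauSum_eq_det (G := segmentMZV α β γ a) (segmentMZV_succ α β γ a) (fun M j k hk => if_pos hk)
          (segmentMZV_zero α β γ a) M (fun _ _ _ => le_rfl) (fun j => by positivity)
          (fun j => le_rfl)]
      congr 1
      ext i j
      have hi : (i : ℕ) ≤ n := Nat.lt_succ_iff.1 i.2
      have hj : (j : ℕ) ≤ n := Nat.lt_succ_iff.1 j.2
      simp only [jacobiTrudiMatrix, Matrix.of_apply, segmentMZV]
      rw [if_neg (by push_cast; omega), ← diagList_eq]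
      congr 2
      · push_cast; ring
      · push_cast; omega
    rw [show truncSchurMZV (rect (a + (n + 1) + c) (n + 1))
        (fun ij => diagSeq α β γ ((ij.2 : ℤ) - (ij.1 : ℤ) + a)) = _ from funext h1]
    exact HasLogExpansion.det fun i j => hasLogExpansion_truncMZV _
  rw [R, if_neg (by omega), regSchurMZV, schurReg_eq hexp, ← Polynomial.coe_evalRingHom,
    RingHom.map_det]
  rfl

end SchurMZV

namespace SchurMZV
open MeasureTheory Complex

/-! ### Products of series and termwise integration over a torus -/

theorem summable_norm_and_tsum_prod {ι : Type*} (m : ℕ) (g : Fin m → ι → ℂ)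
    (hg : ∀ q, Summable fun i => ‖g q i‖) :
    (Summable fun p : Fin m → ι => ‖∏ q, g q (p q)‖) ∧
      ∑' p : Fin m → ι, ∏ q, g q (p q) = ∏ q, ∑' i, g q i := by
  induction m with
  | zero => exact ⟨(hasSum_fintype _).summable, by simp⟩
  | succ m ih =>
    obtain ⟨h1, h2⟩ := ih (fun q => g q.succ) fun q => hg q.succ
    have e : ∀ x : ι × (Fin m → ι), ∏ q, g q (Fin.consEquiv (fun _ => ι) x q) =
        g 0 x.1 * ∏ q : Fin m, g q.succ (x.2 q) := by
      intro x
      rw [Fin.prod_univ_succ]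
      simp [Fin.consEquiv]
    constructor
    · rw [← (Fin.consEquiv fun _ => ι).summable_iff]
      refine ((hg 0).mul_norm h1).congr fun x => ?_
      rw [Function.comp_apply, e]
    · rw [← (Fin.consEquiv fun _ => ι).tsum_eq, tsum_congr e,
        ← tsum_mul_tsum_of_summable_norm (hg 0) h1, h2, Fin.prod_univ_succ]

theorem norm_torusMap_zero {N : ℕ} {r : Fin N → ℝ} (hr : ∀ i, 0 < r i) (θ : Fin N → ℝ)
    (i : Fin N) : ‖torusMap 0 r θ i‖ = r i := by
  simp only [torusMap, Pi.zero_apply, zero_add, norm_mul, norm_exp_ofReal_mul_I, mul_one,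
    norm_real, Real.norm_eq_abs, abs_of_pos (hr i)]

theorem torusMap_zero_ne_zero {N : ℕ} {r : Fin N → ℝ} (hr : ∀ i, 0 < r i) (θ : Fin N → ℝ)
    (i : Fin N) : torusMap 0 r θ i ≠ 0 := by
  rw [← norm_pos_iff, norm_torusMap_zero hr]
  exact hr i

theorem continuous_torusMap_zero {N : ℕ} (r : Fin N → ℝ) : Continuous (torusMap 0 r) := by
  unfold torusMap
  fun_prop

theorem continuous_prod_zpow_torusMap {N : ℕ} {r : Fin N → ℝ} (hr : ∀ i, 0 < r i)
    (e : Fin N → ℤ) : Continuous fun θ => ∏ i, torusMap 0 r θ i ^ e i := by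
  refine continuous_finsetProd _ fun i _ => ?_
  exact Continuous.zpow₀ ((continuous_apply i).comp (continuous_torusMap_zero r)) _
    fun θ => Or.inl (torusMap_zero_ne_zero hr θ i)

theorem torusIntegral_prod_zpow {N : ℕ} {r : Fin N → ℝ} (hr : ∀ i, 0 < r i) (e : Fin N → ℤ) :
    torusIntegral (fun w : Fin N → ℂ => ∏ i, w i ^ e i) 0 r =
      ∏ i, if e i = -1 then 2 * (Real.pi : ℂ) * I else 0 := by
  have h1 : ∀ i, (∫ t in Set.Icc 0 (2 * Real.pi),
      (r i * exp (t * I) * I : ℂ) * (r i * exp (t * I)) ^ e i) =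
      if e i = -1 then 2 * (Real.pi : ℂ) * I else 0 := by
    intro i
    have h2 : (∮ z in C(0, r i), (z - 0) ^ e i) =
        ∫ t in Set.Icc 0 (2 * Real.pi), (r i * exp (t * I) * I : ℂ) * (r i * exp (t * I)) ^ e i := by
      rw [circleIntegral, intervalIntegral.integral_of_le Real.two_pi_pos.le,
        integral_Icc_eq_integral_Ioc]
      refine setIntegral_congr_fun measurableSet_Ioc fun t _ => ?_
      simp [deriv_circleMap, circleMap]
    rw [← h2]
    split_ifs with h
    · rw [h]
      simp only [zpow_neg_one]
      exact circleIntegral.integral_sub_center_inv 0 (hr i).ne'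
    · exact circleIntegral.integral_sub_zpow_of_ne h 0 0 (r i)
  have hIcc : Set.Icc (0 : Fin N → ℝ) (fun _ => 2 * Real.pi) =
      Set.univ.pi fun _ => Set.Icc 0 (2 * Real.pi) := (Set.pi_univ_Icc _ _).symm
  rw [torusIntegral, hIcc, volume_pi, Measure.restrict_pi_pi]
  simp only [torusMap, Pi.zero_apply, zero_add, smul_eq_mul, ← Finset.prod_mul_distrib]
  rw [integral_fintype_prod_eq_prod
    (fun i (t : ℝ) => (r i * exp (t * I) * I : ℂ) * (r i * exp (t * I)) ^ e i)]
  exact Finset.prod_congr rfl fun i _ => h1 i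

/-- Each monomial has constant modulus on the torus, so one summability hypothesis gives uniform
convergence, hence continuity of f, and also permits termwise integration. -/
theorem torusIntegral_of_eq_tsum {ι : Type*} [Countable ι] {N : ℕ} {r : Fin N → ℝ}
    (hr : ∀ i, 0 < r i) (c : ι → ℂ) (e : ι → Fin N → ℤ)
    (hsum : Summable fun p => ‖c p‖ * ∏ i, r i ^ e p i) {f : (Fin N → ℂ) → ℂ}
    (hf : ∀ θ, f (torusMap 0 r θ) = ∑' p, c p * ∏ i, torusMap 0 r θ i ^ e p i) :
    TorusIntegrable f 0 r ∧ torusIntegral f 0 r =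
      ∑' p, c p * ∏ i, if e p i = -1 then 2 * (Real.pi : ℂ) * I else 0 := by
  have hnorm : ∀ p θ, ‖c p * ∏ i, torusMap 0 r θ i ^ e p i‖ = ‖c p‖ * ∏ i, r i ^ e p i := by
    intro p θ
    rw [norm_mul, norm_prod]
    simp only [norm_zpow, norm_torusMap_zero hr]
  have hcont : ∀ p, Continuous fun θ => c p * ∏ i, torusMap 0 r θ i ^ e p i := fun p =>
    continuous_const.mul (continuous_prod_zpow_torusMap hr (e p))
  have hcont' : Continuous fun θ => f (torusMap 0 r θ) := by
    simp only [hf]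
    exact continuous_tsum hcont hsum fun p θ => (hnorm p θ).le
  refine ⟨hcont'.integrableOn_Icc, ?_⟩
  have hD : Continuous fun θ : Fin N → ℝ => (∏ i, r i * exp (θ i * I) * I : ℂ) := by fun_prop
  have hDn : ∀ θ : Fin N → ℝ, ‖(∏ i, r i * exp (θ i * I) * I : ℂ)‖ = ∏ i, r i := by
    intro θ
    simp only [norm_prod, norm_mul, norm_exp_ofReal_mul_I, norm_I, mul_one, norm_real,
      Real.norm_eq_abs, abs_of_pos (hr _)]
  have key := hasSum_integral_of_summable_integral_norm
    (μ := volume.restrict (Set.Icc (0 : Fin N → ℝ) fun _ => 2 * Real.pi))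
    (F := fun p θ => (∏ i, r i * exp (θ i * I) * I : ℂ) *
      (c p * ∏ i, torusMap 0 r θ i ^ e p i))
    (fun p => (hD.mul (hcont p)).integrableOn_Icc) (by
      simp only [norm_mul (∏ i, (r i * exp (_ * I) * I : ℂ)), hDn, hnorm, integral_const, smul_eq_mul]
      exact (hsum.mul_left _).mul_left _)
  rw [torusIntegral]
  simp only [hf, smul_eq_mul, ← tsum_mul_left]
  rw [← key.tsum_eq]
  refine tsum_congr fun p => ?_
  rw [← torusIntegral_prod_zpow hr, ← torusIntegral_const_mul]
  rfl

end SchurMZV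

namespace SchurMZV
open Complex Equiv

/-! ### Expansion of the integrand into monomials -/

section Integrand

variable (α β γ : ℕ+) {n : ℕ} (x z : ℂ)

/-- The coefficient of the monomial indexed by `(τ, p)` in the expansion of the integrand. -/
noncomputable def termCoeff (k : Perm (Fin (n + 1)) × (Fin (n + 1) → ℕ × ℕ)) : ℂ :=
  ((Perm.sign k.1 : ℤ) : ℂ) * x ^ (k.1 0 : ℕ) * (∏ q, (zetaStar α β γ (k.2 q).1 (k.2 q).2 : ℂ)) *
    ∏ i : Fin n, (x ^ (k.2 i.succ).1 * z ^ (k.2 i.succ).2)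

/-- The exponents of `x_2, …, x_b` in the monomial indexed by `(τ, p)`. -/
def termExpX (k : Perm (Fin (n + 1)) × (Fin (n + 1) → ℕ × ℕ)) (i : Fin n) : ℤ :=
  ((k.1 i.succ : ℕ) : ℤ) - ((k.1 0 : ℕ) : ℤ) + (k.2 0).1 - (k.2 i.succ).1 - 1

/-- The exponents of `z_2, …, z_b` in the monomial indexed by `(τ, p)`. -/
def termExpZ (k : Perm (Fin (n + 1)) × (Fin (n + 1) → ℕ × ℕ)) (i : Fin n) : ℤ :=
  ((k.2 0).2 : ℤ) - (k.2 i.succ).2 - ((i : ℕ) + 2 : ℕ)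

/-- The general terms of the series `F(X, Z)` and `F(x / x_i, z / z_i)`. -/
noncomputable def factorTerm (xs zs : Fin n → ℂ) : Fin (n + 1) → ℕ × ℕ → ℂ :=
  Fin.cons (fun p => (zetaStar α β γ p.1 p.2 : ℂ) * (∏ i, xs i) ^ p.1 * (∏ i, zs i) ^ p.2)
    (fun i p => (zetaStar α β γ p.1 p.2 : ℂ) * (x / xs i) ^ p.1 * (z / zs i) ^ p.2)

/-- The factor of the terms indexed by `τ` that does not come from the series. -/
noncomputable def prefactor (xs zs : Fin n → ℂ) (τ : Perm (Fin (n + 1))) : ℂ :=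
  ((Perm.sign τ : ℤ) : ℂ) * ((x / ∏ i, xs i) ^ (τ 0 : ℕ) * ∏ i : Fin n, xs i ^ (τ i.succ : ℕ)) *
    (∏ i, xs i)⁻¹ * ∏ i : Fin n, (zs i ^ ((i : ℕ) + 2))⁻¹

theorem termCoeff_mul_monomial {xs zs : Fin n → ℂ} (hx : ∀ i, xs i ≠ 0) (hz : ∀ i, zs i ≠ 0)
    (k : Perm (Fin (n + 1)) × (Fin (n + 1) → ℕ × ℕ)) :
    termCoeff α β γ x z k * ((∏ i, xs i ^ termExpX k i) * ∏ i, zs i ^ termExpZ k i) =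
      prefactor x xs zs k.1 * ∏ q, factorTerm α β γ x z xs zs q (k.2 q) := by
  have h1 : ∀ i, xs i ^ termExpX k i = xs i ^ (k.1 i.succ : ℕ) * (xs i ^ (k.1 0 : ℕ))⁻¹ *
      xs i ^ (k.2 0).1 * (xs i ^ (k.2 i.succ).1)⁻¹ * (xs i)⁻¹ := by
    intro i
    rw [termExpX, zpow_sub₀ (hx i), zpow_sub₀ (hx i), zpow_add₀ (hx i), zpow_sub₀ (hx i)]
    simp only [zpow_natCast, zpow_one, div_eq_mul_inv]
  have h2 : ∀ i, zs i ^ termExpZ k i = zs i ^ (k.2 0).2 * (zs i ^ (k.2 i.succ).2)⁻¹ *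
      (zs i ^ ((i : ℕ) + 2))⁻¹ := by
    intro i
    rw [termExpZ, zpow_sub₀ (hz i), zpow_sub₀ (hz i)]
    simp only [zpow_natCast, div_eq_mul_inv]
  simp only [h1, h2, termCoeff, prefactor, factorTerm, Fin.prod_univ_succ (n := n), Fin.cons_zero,
    Fin.cons_succ, Finset.prod_mul_distrib, Finset.prod_inv_distrib, Finset.prod_pow, mul_pow, inv_pow,
    div_eq_mul_inv]
  ring

/-- Leibniz expansion of the Vandermonde determinant at the nodes x/X, x_2, …, x_b. Differences with
the first node are (X x_i - x)/X, which together with the extra X⁻¹ account for X^{n+1}. -/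
theorem sum_prefactor_eq {xs : Fin n → ℂ} (hx : ∀ i, xs i ≠ 0) (zs : Fin n → ℂ) :
    ∑ τ, prefactor x xs zs τ = (∏ i, ∏ j ∈ Finset.Ioi i, (xs j - xs i)) /
      (∏ i, xs i) ^ (n + 1) * ∏ i : Fin n, (((∏ i, xs i) * xs i - x) / zs i ^ ((i : ℕ) + 2)) := by
  set X := ∏ i, xs i with hX
  have hX0 : X ≠ 0 := Finset.prod_ne_zero_iff.2 fun i _ => hx i
  have h1 := Matrix.det_vandermonde (Fin.cons (x / X) xs : Fin (n + 1) → ℂ)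
  rw [← Matrix.det_transpose, Matrix.det_apply'] at h1
  simp only [Matrix.transpose_apply, Matrix.vandermonde_apply, Fin.prod_univ_succ (n := n),
    Fin.cons_zero, Fin.cons_succ, Fin.prod_Ioi_zero, Fin.prod_Ioi_succ] at h1
  have h2 : ∏ i : Fin n, (xs i - x / X) = (∏ i, (X * xs i - x)) / X ^ n := by
    have : ∀ i, xs i - x / X = (X * xs i - x) / X := fun i => by field_simp
    simp only [this, Finset.prod_div_distrib, Finset.prod_const, Finset.card_univ, Fintype.card_fin]
  rw [h2] at h1
  simp only [prefactor, ← hX, ← Finset.sum_mul, h1, Finset.prod_div_distrib,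
    Finset.prod_inv_distrib]
  rw [pow_succ]
  field_simp

theorem summable_norm_factorTerm {xs zs : Fin n → ℂ}
    (h0 : FConvergesAt α β γ (∏ i, ‖xs i‖) (∏ i, ‖zs i‖))
    (h1 : ∀ i, FConvergesAt α β γ (‖x‖ / ‖xs i‖) (‖z‖ / ‖zs i‖)) (q : Fin (n + 1)) :
    Summable fun p => ‖factorTerm α β γ x z xs zs q p‖ := by
  have e : ∀ (u v : ℂ) (p : ℕ × ℕ), ‖(zetaStar α β γ p.1 p.2 : ℂ) * u ^ p.1 * v ^ p.2‖ =
      |zetaStar α β γ p.1 p.2| * ‖u‖ ^ p.1 * ‖v‖ ^ p.2 := by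
    intro u v p
    rw [norm_mul, norm_mul, norm_pow, norm_pow, norm_real, Real.norm_eq_abs]
  induction q using Fin.cases with
  | zero =>
    simp only [factorTerm, Fin.cons_zero, e, norm_prod]
    exact h0
  | succ i =>
    simp only [factorTerm, Fin.cons_succ, e, norm_div]
    exact h1 i

theorem summable_norm_terms {xs zs : Fin n → ℂ} (hx : ∀ i, xs i ≠ 0) (hz : ∀ i, zs i ≠ 0)
    (h0 : FConvergesAt α β γ (∏ i, ‖xs i‖) (∏ i, ‖zs i‖))
    (h1 : ∀ i, FConvergesAt α β γ (‖x‖ / ‖xs i‖) (‖z‖ / ‖zs i‖)) :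
    Summable fun k : Perm (Fin (n + 1)) × (Fin (n + 1) → ℕ × ℕ) =>
      ‖termCoeff α β γ x z k * ((∏ i, xs i ^ termExpX k i) * ∏ i, zs i ^ termExpZ k i)‖ := by
  have h2 := (summable_norm_and_tsum_prod (n + 1) _ (summable_norm_factorTerm α β γ x z h0 h1)).1
  have h3 : Summable fun τ : Perm (Fin (n + 1)) => ‖prefactor x xs zs τ‖ :=
    (hasSum_fintype _).summable
  refine (h3.mul_norm h2).congr fun k => ?_
  rw [termCoeff_mul_monomial α β γ x z hx hz]

theorem integrand_eq_tsum {w : Fin (n + n) → ℂ} (hw : ∀ i, w i ≠ 0)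
    (h0 : FConvergesAt α β γ (∏ i, ‖w (Fin.castAdd n i)‖) (∏ i, ‖w (Fin.natAdd n i)‖))
    (h1 : ∀ i, FConvergesAt α β γ (‖x‖ / ‖w (Fin.castAdd n i)‖) (‖z‖ / ‖w (Fin.natAdd n i)‖)) :
    integrand α β γ (n + 1) x z w =
      ∑' k : Perm (Fin (n + 1)) × (Fin (n + 1) → ℕ × ℕ), termCoeff α β γ x z k *
        ∏ i, w i ^ (Fin.append (termExpX k) (termExpZ k) i) := by
  set xs : Fin n → ℂ := fun i => w (Fin.castAdd n i) with hxs
  set zs : Fin n → ℂ := fun i => w (Fin.natAdd n i) with hzs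
  have hx : ∀ i, xs i ≠ 0 := fun i => hw _
  have hz : ∀ i, zs i ≠ 0 := fun i => hw _
  simp only [Fin.prod_univ_add, Fin.append_left, Fin.append_right]
  change _ = ∑' k, termCoeff α β γ x z k *
    ((∏ i, xs i ^ termExpX k i) * ∏ i, zs i ^ termExpZ k i)
  simp only [termCoeff_mul_monomial α β γ x z hx hz]
  obtain ⟨h2, h3⟩ := summable_norm_and_tsum_prod (n + 1) _
    (summable_norm_factorTerm α β γ x z (xs := xs) (zs := zs) h0 h1)
  have h4 : Summable fun τ : Perm (Fin (n + 1)) => ‖prefactor x xs zs τ‖ :=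
    (hasSum_fintype _).summable
  rw [← tsum_mul_tsum_of_summable_norm h4 h2, h3, tsum_fintype, sum_prefactor_eq x hx,
    Fin.prod_univ_succ]
  change (∏ i : Fin n, ∏ j ∈ Finset.Ioi i, (xs j - xs i)) *
    (F α β γ (∏ i, xs i) (∏ i, zs i) / (∏ i, xs i) ^ (n + 1)) *
    ∏ i : Fin n, (((∏ i, xs i) * xs i - x) / zs i ^ ((i : ℕ) + 2) *
      F α β γ (x / xs i) (z / zs i)) = _ / _ * _ * (F α β γ (∏ i, xs i) (∏ i, zs i) *
        ∏ i : Fin n, F α β γ (x / xs i) (z / zs i))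
  rw [Finset.prod_mul_distrib]
  ring

/-! ### The monomials with nonzero integral -/

/-- The index of the term of `Φ_b` with permutation `τ` and exponents `(a, c)`. -/
def residueIndex (k : Perm (Fin (n + 1)) × (ℕ × ℕ)) :
    Perm (Fin (n + 1)) × (Fin (n + 1) → ℕ × ℕ) :=
  (k.1, fun q => (k.2.1 + (k.1 q : ℕ), k.2.2 + (n - q)))

theorem residueIndex_injective : Function.Injective (residueIndex (n := n)) := by
  rintro ⟨τ, a, c⟩ ⟨τ', a', c'⟩ h
  simp only [residueIndex, Prod.mk.injEq] at h
  obtain ⟨rfl, h⟩ := h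
  have h0 := congrFun h 0
  simp only [Prod.mk.injEq] at h0
  obtain ⟨h1, h2⟩ := h0
  obtain rfl : a = a' := by omega
  obtain rfl : c = c' := by omega
  rfl

theorem termExp_residueIndex (k : Perm (Fin (n + 1)) × (ℕ × ℕ)) (i : Fin n) :
    termExpX (residueIndex k) i = -1 ∧ termExpZ (residueIndex k) i = -1 := by
  have hi := i.2
  constructor
  · simp only [termExpX, residueIndex]
    push_cast
    ring
  · simp only [termExpZ, residueIndex, Fin.val_succ, Fin.val_zero]
    omega

/-- The conditions say that the first exponent minus τ q and the second exponent plus q do not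
depend on q. -/
theorem mem_range_residueIndex {k : Perm (Fin (n + 1)) × (Fin (n + 1) → ℕ × ℕ)}
    (hX : ∀ i, termExpX k i = -1) (hZ : ∀ i, termExpZ k i = -1) :
    k ∈ Set.range (residueIndex (n := n)) := by
  obtain ⟨τ, p⟩ := k
  have h1 : ∀ q, ((p q).1 : ℤ) - (τ q : ℕ) = (p 0).1 - (τ 0 : ℕ) := by
    intro q
    induction q using Fin.cases with
    | zero => rfl
    | succ i =>
      have := hX i
      simp only [termExpX] at this
      omega
  have h2 : ∀ q : Fin (n + 1), ((p q).2 : ℤ) + (q : ℕ) = (p 0).2 := by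
    intro q
    induction q using Fin.cases with
    | zero => simp
    | succ i =>
      have := hZ i
      simp only [termExpZ] at this
      rw [Fin.val_succ]
      push_cast at this ⊢
      omega
  -- The two constants are read off where τ q = 0 and where q = n, which shows that they are natural
  -- numbers.
  refine ⟨(τ, (p (τ.symm 0)).1, (p (Fin.last n)).2), ?_⟩
  simp only [residueIndex, Prod.mk.injEq, true_and]
  funext q
  have e1 := h1 q
  have e2 := h1 (τ.symm 0)
  have e3 := h2 q
  have e4 := h2 (Fin.last n)
  have e5 : (q : ℕ) ≤ n := Nat.lt_succ_iff.1 q.2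
  simp only [Equiv.apply_symm_apply, Fin.val_zero, Fin.val_last] at e2 e4
  refine Prod.ext ?_ ?_
  · simp only; omega
  · simp only; omega

theorem sum_fin_val (m : ℕ) : ∑ q : Fin (m + 1), (q : ℕ) = (m + 1) * m / 2 := by
  rw [Fin.sum_univ_eq_sum_range (fun i => i), Finset.sum_range_id, Nat.add_sub_cancel]

/-- The node x/X supplies x^{τ 0} and the other factors x^{a + τ q} for q ≥ 1. As τ permutes 0, …,
n, the total is n a + n(n+1)/2 for every τ; likewise z gets n c + n(n-1)/2. Thus only the sign and
the zeta values depend on τ. -/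
theorem termCoeff_residueIndex (τ : Perm (Fin (n + 1))) (a c : ℕ) :
    termCoeff α β γ x z (residueIndex (τ, a, c)) =
      x ^ ((n + 1) * n / 2) * z ^ (n * (n - 1) / 2) * (x ^ (n * a) * z ^ (n * c)) *
        (((Perm.sign τ : ℤ) : ℂ) *
          ∏ q, (zetaStar α β γ (a + (τ q : ℕ)) (c + (n - q)) : ℂ)) := by
  have hX : x ^ (τ 0 : ℕ) * ∏ i : Fin n, x ^ (a + (τ i.succ : ℕ)) =
      x ^ ((n + 1) * n / 2) * x ^ (n * a) := by
    rw [Finset.prod_pow_eq_pow_sum, ← pow_add, ← pow_add, Finset.sum_add_distrib]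
    congr 1
    have h := Equiv.sum_comp τ (fun q : Fin (n + 1) => (q : ℕ))
    rw [sum_fin_val, Fin.sum_univ_succ] at h
    simp only [Finset.sum_const, Finset.card_univ, Fintype.card_fin, smul_eq_mul]
    omega
  have hZ : ∏ i : Fin n, z ^ (c + (n - (i.succ : ℕ))) =
      z ^ (n * (n - 1) / 2) * z ^ (n * c) := by
    rw [Finset.prod_pow_eq_pow_sum, ← pow_add, Finset.sum_add_distrib]
    congr 1
    have h : ∑ i : Fin n, (n - (i.succ : ℕ)) = n * (n - 1) / 2 := by
      rw [← Finset.sum_range_id, ← Finset.sum_range_reflect,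
        ← Fin.sum_univ_eq_sum_range (fun i => n - 1 - i)]
      refine Finset.sum_congr rfl fun i _ => ?_
      rw [Fin.val_succ]
      omega
    simp only [h, Finset.sum_const, Finset.card_univ, Fintype.card_fin, smul_eq_mul]
    omega
  simp only [termCoeff, residueIndex, Finset.prod_mul_distrib, hZ]
  linear_combination (((Perm.sign τ : ℤ) : ℂ) *
    (∏ q : Fin (n + 1), (zetaStar α β γ (a + (τ q : ℕ)) (c + (n - q)) : ℂ)) *
      (z ^ (n * (n - 1) / 2) * z ^ (n * c))) * hX

theorem sum_termCoeff_residueIndex (p : ℕ × ℕ) :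
    ∑ τ : Perm (Fin (n + 1)), termCoeff α β γ x z (residueIndex (τ, p)) =
      PhiFactor (n + 1) x z * PhiTerm α β γ (n + 1) x z p := by
  obtain ⟨a, c⟩ := p
  simp only [termCoeff_residueIndex, ← Finset.mul_sum]
  have h : (R α β γ (a : ℤ) (a + (n + 1) + c) (n + 1) : ℂ) = ∑ τ : Perm (Fin (n + 1)),
      ((Perm.sign τ : ℤ) : ℂ) * ∏ q, (zetaStar α β γ (a + (τ q : ℕ)) (c + (n - q)) : ℂ) := by
    -- The transpose is needed because τ acts here on the column index j of the entry a + j.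
    rw [R_eq_det, ← Matrix.det_transpose, Matrix.det_apply']
    push_cast
    rfl
  rw [← h]
  change _ = x ^ ((n + 1) * n / 2) * z ^ (n * (n - 1) / 2) *
    ((R α β γ (a : ℤ) (a + (n + 1) + c) (n + 1) : ℂ) * x ^ (n * a) * z ^ (n * c))
  ring

theorem contourFormula_succ {ρ σ : Fin n → ℝ} (hρ : ∀ i, 0 < ρ i) (hσ : ∀ i, 0 < σ i)
    (h0 : FConvergesAt α β γ (∏ i, ρ i) (∏ i, σ i))
    (h1 : ∀ i, FConvergesAt α β γ (‖x‖ / ρ i) (‖z‖ / σ i)) :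
    ContourFormula α β γ (n + 1) ρ σ x z := by
  classical
  set r : Fin (n + n) → ℝ := Fin.append ρ σ with hr_def
  have hr : ∀ i, 0 < r i := by
    intro i
    induction i using Fin.addCases with
    | left i => rw [hr_def, Fin.append_left]; exact hρ i
    | right i => rw [hr_def, Fin.append_right]; exact hσ i
  have hsum : Summable fun k : Perm (Fin (n + 1)) × (Fin (n + 1) → ℕ × ℕ) =>
      ‖termCoeff α β γ x z k‖ * ∏ i, r i ^ (Fin.append (termExpX k) (termExpZ k) i) := by
    have hρ' : ∀ i, ‖(ρ i : ℂ)‖ = ρ i := fun i => by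
      rw [norm_real, Real.norm_eq_abs, abs_of_pos (hρ i)]
    have hσ' : ∀ i, ‖(σ i : ℂ)‖ = σ i := fun i => by
      rw [norm_real, Real.norm_eq_abs, abs_of_pos (hσ i)]
    have := summable_norm_terms α β γ x z (xs := fun i => (ρ i : ℂ)) (zs := fun i => (σ i : ℂ))
      (fun i => ofReal_ne_zero.2 (hρ i).ne') (fun i => ofReal_ne_zero.2 (hσ i).ne')
      (by simpa only [hρ', hσ'] using h0) (by simpa only [hρ', hσ'] using h1)
    refine this.congr fun k => ?_
    simp only [norm_mul, norm_prod, norm_zpow, hρ', hσ', Fin.prod_univ_add, hr_def,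
      Fin.append_left, Fin.append_right]
  have hnρ : ∀ θ i, ‖torusMap 0 r θ (Fin.castAdd n i)‖ = ρ i := fun θ i => by
    rw [norm_torusMap_zero hr, hr_def, Fin.append_left]
  have hnσ : ∀ θ i, ‖torusMap 0 r θ (Fin.natAdd n i)‖ = σ i := fun θ i => by
    rw [norm_torusMap_zero hr, hr_def, Fin.append_right]
  obtain ⟨hint, hval⟩ := torusIntegral_of_eq_tsum hr (termCoeff α β γ x z)
    (fun k => Fin.append (termExpX k) (termExpZ k)) hsum (f := integrand α β γ (n + 1) x z)
    (fun θ => by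
      refine integrand_eq_tsum α β γ x z (torusMap_zero_ne_zero hr θ) ?_ ?_
      · simpa only [hnρ, hnσ] using h0
      · simpa only [hnρ, hnσ] using h1)
  have hprod : ∀ k : Perm (Fin (n + 1)) × (ℕ × ℕ), ∀ i,
      Fin.append (termExpX (residueIndex k)) (termExpZ (residueIndex k)) i = -1 := by
    intro k i
    induction i using Fin.addCases with
    | left i => rw [Fin.append_left]; exact (termExp_residueIndex k i).1
    | right i => rw [Fin.append_right]; exact (termExp_residueIndex k i).2
  -- On the surviving indices the modulus of the monomial is the constant ∏ r_i⁻¹ ≠ 0, so absolute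
  -- summability passes to the coefficients.
  have hcoeff : Summable fun k : Perm (Fin (n + 1)) × (ℕ × ℕ) =>
      termCoeff α β γ x z (residueIndex k) := by
    have h2 := hsum.comp_injective (residueIndex_injective (n := n))
    simp only [Function.comp_def, hprod] at h2
    have h3 : (∏ i, r i ^ (-1 : ℤ)) ≠ 0 :=
      Finset.prod_ne_zero_iff.2 fun i _ => zpow_ne_zero _ (hr i).ne'
    exact ((summable_mul_right_iff h3).1 h2).of_norm
  have hcoeff' : ∀ τ : Perm (Fin (n + 1)), Summable fun p : ℕ × ℕ =>
      termCoeff α β γ x z (residueIndex (τ, p)) := fun τ => hcoeff.prod_factor τ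
  refine ⟨hint, ?_, ?_⟩
  · simp only [← sum_termCoeff_residueIndex]
    exact summable_sum fun τ _ => hcoeff' τ
  · change Phi α β γ (n + 1) x z = 1 / (2 * (Real.pi : ℂ) * I) ^ (2 * n) *
      torusIntegral (integrand α β γ (n + 1) x z) 0 r
    have hpi : (2 * (Real.pi : ℂ) * I) ^ (2 * n) ≠ 0 := pow_ne_zero _ Complex.two_pi_I_ne_zero
    have hPhi : Phi α β γ (n + 1) x z = ∑' k : Perm (Fin (n + 1)) × (ℕ × ℕ),
        termCoeff α β γ x z (residueIndex k) := by
      rw [Phi, ← tsum_mul_left, hcoeff.tsum_prod' hcoeff',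
        tsum_fintype (fun τ : Perm (Fin (n + 1)) =>
          ∑' p : ℕ × ℕ, termCoeff α β γ x z (residueIndex (τ, p))),
        ← Summable.tsum_finsetSum fun τ _ => hcoeff' τ]
      exact tsum_congr fun p => (sum_termCoeff_residueIndex α β γ x z p).symm
    -- The sum may be restricted to the range of `residueIndex`, since any other index has some
    -- exponent different from -1 and so a zero factor. Each remaining term carries (2πi)^{2n},
    -- which the normalization cancels.
    rw [hval, ← (residueIndex_injective (n := n)).tsum_eq, hPhi]
    · simp only [hprod, if_true, Finset.prod_const, Finset.card_univ, Fintype.card_fin,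
        tsum_mul_right]
      rw [← two_mul]
      field_simp
    · intro k hk
      refine mem_range_residueIndex (fun i => ?_) fun i => ?_ <;>
        by_contra hne <;> refine hk (mul_eq_zero_of_right _ ?_)
      · exact Finset.prod_eq_zero (Finset.mem_univ (Fin.castAdd n i))
          (by rw [Fin.append_left, if_neg hne])
      · exact Finset.prod_eq_zero (Finset.mem_univ (Fin.natAdd n i))
          (by rw [Fin.append_right, if_neg hne])

end Integrand

end SchurMZV

theorem mainTheorem9 (α β γ : ℕ+) (b : ℕ) (hb : 2 ≤ b) :
    -- the formula over unit circles, whenever the series for `F` in the integrand converge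
    (∀ x z : ℂ, SchurMZV.FConvergesAt α β γ 1 1 → SchurMZV.FConvergesAt α β γ ‖x‖ ‖z‖ →
      SchurMZV.ContourFormula α β γ b (fun _ => 1) (fun _ => 1) x z) ∧
    -- the same over circles of arbitrary radii
    (∀ (ρ σ : Fin (b - 1) → ℝ) (x z : ℂ), (∀ i, 0 < ρ i) → (∀ i, 0 < σ i) →
      SchurMZV.FConvergesAt α β γ (∏ i, ρ i) (∏ i, σ i) →
      (∀ i, SchurMZV.FConvergesAt α β γ (‖x‖ / ρ i) (‖z‖ / σ i)) →
      SchurMZV.ContourFormula α β γ b ρ σ x z) ∧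
    -- the series for `F` always converges near the origin
    (∃ r : ℝ, 0 < r ∧ SchurMZV.FConvergesAt α β γ r r) := by
  obtain ⟨n, rfl⟩ : ∃ n, b = n + 1 := ⟨b - 1, by omega⟩
  refine ⟨fun x z h0 h1 => ?_, fun ρ σ x z hρ hσ h0 h1 => ?_, SchurMZV.exists_FConvergesAt α β γ⟩
  · refine SchurMZV.contourFormula_succ α β γ x z (n := n) (fun _ => one_pos) (fun _ => one_pos)
      ?_ fun _ => ?_
    · simpa using h0
    · simpa using h1
  · exact SchurMZV.contourFormula_succ α β γ x z (n := n) hρ hσ h0 h1
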